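/- All functions are real-valued functions on $(0,\infty)$. Let $C_{-1}$ be the set of functions $f(t)=t^pf_1(t)$, $t>0$, with some $p>-1$ and $f_1\in C[0,\infty)$, let $C_{-1}^{m}=\{f\in C_{-1}: f^{(m)}\in C_{-1}\}$, and let $(f*g)(t)=\int_0^t f(t-\tau)g(\tau)\,d\tau$. For $n\in\mathbb N$, $n\ge 1$, let $\mathcal L_n$ be the set of pairs $(\kappa,k)$ such that $\kappa\in C_{-1}$, $k(t)=t^pk_1(t)$ with some $-1<p<0$ and $k_1\in C[0,\infty)$, $k$ has a singularity at the origin (it is unbounded near $0$), and $(\kappa*k)(t)=\frac{t^{n-1}}{(n-1)!}$ for $t>0$. Put $I_{(\kappa)}f=\kappa*f$, $I_{(k)}f=k*f$, $D_{(k)}f=\frac{d^n}{dt^n}(k*f)$, let $C^{(1)}_{-1,(k)}$ be the set of $f\in C_{-1}$ for which $D_{(k)}f$ exists and belongs to $C_{-1}$, let $\operatorname{Ker}D_{(k)}=\{f\in C^{(1)}_{-1,(k)}: D_{(k)}f=0\}$, and let $Ff=f-I_{(\kappa)}D_{(k)}f$ for $f\in C^{(1)}_{-1,(k)}$. For $\lambda\in\mathbb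 R$ let $$l_{\kappa,\lambda}(t)=\sum_{j=1}^{\infty}\lambda^{j-1}\kappa^{<j>}(t),\qquad t>0,$$ where $\kappa^{<j>}$ is the $j$-fold convolution power of $\kappa$ and $\lambda^0=1$. **Theorem.** Let $(\kappa,k)\in\mathcal L_n$, $\kappa\in C_{-1}^{n-1}$, $f\in C_{-1}$ and $\lambda\in\mathbb R$. The series $l_{\kappa,\lambda}$ converges for every $t>0$, its sum belongs to $C_{-1}$ and is $n-1$ times continuously differentiable on $(0,\infty)$, and the following hold. (1) For every $\gamma_0\in\operatorname{Ker}D_{(k)}$, the Cauchy problem $D_{(k)}y-\lambda y=f$, $Fy=\gamma_0$ has exactly one solution $y\in C^{(1)}_{-1,(k)}$, namely $$y=y_f+y_{iv},\qquad y_f=f*l_{\kappa,\lambda},\qquad y_{iv}=\gamma_0+\lambda\,(\gamma_0*l_{\kappa,\lambda}).$$ (2) For all $a_0,\dots,a_{n-1}\in\mathbb R$, the Cauchy problem $D_{(k)}y-\lambda y=f$, $\left(\frac{d^i}{dt^i}I_{(k)}y\right)(0)=a_i$ for $i=0,\dots,n-1$ (values at $0$ being limits as $t\to0+$) has exactly one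 solution $y\in C^{(1)}_{-1,(k)}$, namely $$y=y_f+y_{iv},\qquad y_f=f*l_{\kappa,\lambda},\qquad y_{iv}=\sum_{i=0}^{n-1}a_i\,\frac{d^{\,n-1-i}}{dt^{\,n-1-i}}l_{\kappa,\lambda}.$$ In both cases $y_f$ is the unique solution of the problem with homogeneous initial condition ($\gamma_0=0$, respectively $a_0=\dots=a_{n-1}=0$), and $y_{iv}$ is the unique solution of the problem with $f=0$. -/

import Mathlib

open Set Filter Topology

noncomputable section

namespace GenFrac

/-- The space `C_{-1}(0,∞)`. Functions on `(0,∞)` are represented by functions `ℝ → ℝ`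
of which only the values at `t > 0` matter. -/
def CMinusOne : Set (ℝ → ℝ) :=
  {f | ∃ p : ℝ, -1 < p ∧ ∃ f₁ : ℝ → ℝ, ContinuousOn f₁ (Ici 0) ∧
    ∀ t : ℝ, 0 < t → f t = t ^ p * f₁ t}

/-- The space `C_{-1,0}(0,∞)`. -/
def CMinusOneZero : Set (ℝ → ℝ) :=
  {f | ∃ p : ℝ, -1 < p ∧ p < 0 ∧ ∃ f₁ : ℝ → ℝ, ContinuousOn f₁ (Ici 0) ∧
    ∀ t : ℝ, 0 < t → f t = t ^ p * f₁ t}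

/-- The space `C_{-1}^m(0,∞)`: functions of `C_{-1}` that are `m` times (continuously)
differentiable on `(0,∞)` with `m`-th derivative in `C_{-1}`. -/
def CMinusOneDiff (m : ℕ) : Set (ℝ → ℝ) :=
  {f | f ∈ CMinusOne ∧ ContDiffOn ℝ (m : WithTop ℕ∞) f (Ioi 0) ∧
    iteratedDeriv m f ∈ CMinusOne}

/-- The Laplace convolution `(f * g)(t) = ∫₀ᵗ f(t - τ) g(τ) dτ`. -/
def conv (f g : ℝ → ℝ) (t : ℝ) : ℝ := ∫ τ in (0 : ℝ)..t, f (t - τ) * g τ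

/-- The convolution powers `g^{<m>}`. -/
def convPow (g : ℝ → ℝ) : ℕ → ℝ → ℝ
  | 0 => fun _ => 1
  | 1 => g
  | m + 2 => conv g (convPow g (m + 1))

/-- The set `𝓛_n` of pairs of kernels `(κ, k)`. The function `k` has a singularity at the
origin, that is, it is unbounded near `0` (this does not follow from `k ∈ C_{-1,0}`). -/
structure KernelPair (n : ℕ) (κ k : ℝ → ℝ) : Prop where
  one_le : 1 ≤ n
  kappa_mem : κ ∈ CMinusOne
  k_mem : k ∈ CMinusOneZero
  k_singular : ¬ (k =O[𝓝[>] (0 : ℝ)] fun _ => (1 : ℝ))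
  conv_eq : ∀ t : ℝ, 0 < t → conv κ k t = t ^ (n - 1) / ((n - 1).factorial : ℝ)

/-- The general fractional integral `I_(κ) f = κ * f`. -/
def gfi (κ f : ℝ → ℝ) : ℝ → ℝ := conv κ f

/-- The general fractional derivative `D_(k) f = (d/dt)^n (k * f)` of Riemann-Liouville type. -/
def gfd (n : ℕ) (k f : ℝ → ℝ) : ℝ → ℝ := iteratedDeriv n (gfi k f)

/-- The natural domain `C^{(1)}_{-1,(k)}(0,∞)` of `D_(k)`: functions `f` of `C_{-1}` whose
derivative `D_(k) f` exists on `(0,∞)` and belongs to `C_{-1}` (so it is continuous). -/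
def gfdDomain (n : ℕ) (k : ℝ → ℝ) : Set (ℝ → ℝ) :=
  {f | f ∈ CMinusOne ∧ ContDiffOn ℝ (n : WithTop ℕ∞) (gfi k f) (Ioi 0) ∧
    gfd n k f ∈ CMinusOne}

/-- The null space of `D_(k)`. -/
def gfdKer (n : ℕ) (k : ℝ → ℝ) : Set (ℝ → ℝ) :=
  {f | f ∈ gfdDomain n k ∧ ∀ t : ℝ, 0 < t → gfd n k f t = 0}

/-- The projector operator `F f = f - I_(κ) D_(k) f`. -/
def projector (n : ℕ) (κ k f : ℝ → ℝ) (t : ℝ) : ℝ := f t - gfi κ (gfd n k f) t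

/-- The convolution series `l_{κ,λ} = ∑_{j ≥ 1} λ^{j-1} κ^{<j>}` (here `j` is shifted by one). -/
def convSeries (κ : ℝ → ℝ) (lam : ℝ) (t : ℝ) : ℝ :=
  ∑' j : ℕ, lam ^ j * convPow κ (j + 1) t

/-- `y` lies in the domain of `D_(k)` and `D_(k) y - λ y = f` on `(0,∞)`. -/
def SolvesEquation (n : ℕ) (k : ℝ → ℝ) (lam : ℝ) (f y : ℝ → ℝ) : Prop :=
  y ∈ gfdDomain n k ∧ ∀ t : ℝ, 0 < t → gfd n k y t - lam * y t = f t

/-- The Cauchy problem `D_(k) y - λ y = f`, `F y = γ₀`. -/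
def SolvesProjectorProblem (n : ℕ) (κ k : ℝ → ℝ) (lam : ℝ) (f γ₀ y : ℝ → ℝ) : Prop :=
  SolvesEquation n k lam f y ∧ ∀ t : ℝ, 0 < t → projector n κ k y t = γ₀ t

/-- The Cauchy problem `D_(k) y - λ y = f`, `((d/dt)^i I_(k) y)(0) = a_i` for `i < n`.
The value at `0` of a function on `(0,∞)` is its limit as `t → 0+`. -/
def SolvesInitialValueProblem (n : ℕ) (k : ℝ → ℝ) (lam : ℝ) (f : ℝ → ℝ) (a : Fin n → ℝ)
    (y : ℝ → ℝ) : Prop :=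
  SolvesEquation n k lam f y ∧
    ∀ i : Fin n, Tendsto (iteratedDeriv (i : ℕ) (gfi k y)) (𝓝[>] 0) (𝓝 (a i))

end GenFrac

end

open MeasureTheory

/-! Write l for the convolution series. It is the resolvent of κ: l = κ + λ κ*l (`convSeries_eq`).
Convolving D_(k)y = λy + f with κ and using Fy = γ₀ gives the Volterra equation y = w + λ κ*y with w
= γ₀ + κ*f. Its only solution in C_{-1} is w + λ l*w (`volterra_iff`), and the resolvent identity
collapses κ*f + λ l*(κ*f) to l*f. Conversely such a y equals γ₀ + κ*g with g = f + λy; since k*(κ*g)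
is the n-fold primitive of g, D_(k)y = g (`KernelPair.gfd_of_eq_add_conv`).

The series converges like a Mittag-Leffler series: a bound |κ| ≤ M t^p on (0,T] propagates through
Beta integrals and puts Γ(j(p+1)) in the denominator of the bound for the j-th power.

The problem with initial values is the projector problem for γ₀ = ∑ a_i κ^{(n-1-i)}. This rests on
k*κ^{(i)} = t^{n-1-i}/(n-1-i)!, that is, on differentiating k*κ without boundary terms. A nonzero
value c = κ^{(i)}(0+) with i < n-1 would give c k + k*κ^{(i+1)} = t^m/m!, a Volterra equation whose
solutions in C_{-1} are bounded near 0, against the singularity of k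
(`eq_prim_and_conv_of_conv_eq_pow`). The case i = n-1 reads k*κ^{(n-1)} = 1; hence convolution with
k is injective and the initial values determine Fy. -/

namespace GenFrac

/-! ### Power representations of functions in C_{-1}. -/

/-- `f` agrees on `(0,∞)` with `t ↦ t ^ p * f₁ t` for some continuous `f₁ : ℝ → ℝ`. -/
def HasPowRep (p : ℝ) (f : ℝ → ℝ) : Prop :=
  ∃ f₁ : ℝ → ℝ, Continuous f₁ ∧ ∀ t : ℝ, 0 < t → f t = t ^ p * f₁ t

theorem hasPowRep_of_continuousOn {p : ℝ} {f f₁ : ℝ → ℝ} (hc : ContinuousOn f₁ (Ici 0))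
    (h : ∀ t : ℝ, 0 < t → f t = t ^ p * f₁ t) : HasPowRep p f := by
  -- Composing with `max t 0` extends the factor from [0,∞) to a continuous function on ℝ.
  refine ⟨fun t => f₁ (max t 0),
    hc.comp_continuous (by fun_prop) fun t => mem_Ici.2 (le_max_right t 0), ?_⟩
  intro t ht
  simp only [h t ht, max_eq_left ht.le]

theorem mem_CMinusOne_iff {f : ℝ → ℝ} : f ∈ CMinusOne ↔ ∃ p : ℝ, -1 < p ∧ HasPowRep p f := by
  constructor
  · rintro ⟨p, hp, f₁, hc, h⟩
    exact ⟨p, hp, hasPowRep_of_continuousOn hc h⟩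
  · rintro ⟨p, hp, f₁, hc, h⟩
    exact ⟨p, hp, f₁, hc.continuousOn, h⟩

namespace HasPowRep

variable {p q : ℝ} {f g : ℝ → ℝ}

theorem mem (h : HasPowRep p f) (hp : -1 < p) : f ∈ CMinusOne :=
  mem_CMinusOne_iff.2 ⟨p, hp, h⟩

theorem congr (h : HasPowRep p f) (hfg : ∀ t : ℝ, 0 < t → g t = f t) : HasPowRep p g := by
  obtain ⟨f₁, hc, h⟩ := h
  exact ⟨f₁, hc, fun t ht => (hfg t ht).trans (h t ht)⟩

theorem mono (h : HasPowRep p f) (hq : q ≤ p) : HasPowRep q f := by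
  obtain ⟨f₁, hc, h⟩ := h
  refine ⟨fun t => (max t 0) ^ (p - q) * f₁ t, ?_, fun t ht => ?_⟩
  · exact ((continuous_id.max continuous_const).rpow_const
      fun t => Or.inr (sub_nonneg.2 hq)).mul hc
  · simp only
    rw [h t ht, max_eq_left ht.le, ← mul_assoc, ← Real.rpow_add ht]
    congr 2; ring

theorem add (hf : HasPowRep p f) (hg : HasPowRep p g) : HasPowRep p (fun t => f t + g t) := by
  obtain ⟨f₁, hfc, hf⟩ := hf
  obtain ⟨g₁, hgc, hg⟩ := hg
  exact ⟨fun t => f₁ t + g₁ t, hfc.add hgc, fun t ht => by simp only; rw [hf t ht, hg t ht]; ring⟩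

theorem const_mul (c : ℝ) (hf : HasPowRep p f) : HasPowRep p (fun t => c * f t) := by
  obtain ⟨f₁, hfc, hf⟩ := hf
  exact ⟨fun t => c * f₁ t, hfc.const_mul c, fun t ht => by simp only; rw [hf t ht]; ring⟩

theorem abs (hf : HasPowRep p f) : HasPowRep p (fun t => |f t|) := by
  obtain ⟨f₁, hfc, hf⟩ := hf
  refine ⟨fun t => |f₁ t|, hfc.abs, fun t ht => ?_⟩
  simp only
  rw [hf t ht, abs_mul, abs_of_pos (Real.rpow_pos_of_pos ht p)]

theorem continuousOn (hf : HasPowRep p f) : ContinuousOn f (Ioi 0) := by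
  obtain ⟨f₁, hfc, hf⟩ := hf
  refine ContinuousOn.congr (f := fun t => t ^ p * f₁ t) ?_ fun t ht => hf t ht
  exact (continuousOn_id.rpow_const fun t ht => Or.inl (ne_of_gt ht)).mul hfc.continuousOn

theorem exists_abs_le (hf : HasPowRep p f) (T : ℝ) :
    ∃ M, 0 ≤ M ∧ ∀ t, 0 < t → t ≤ T → |f t| ≤ M * t ^ p := by
  obtain ⟨f₁, hfc, hf⟩ := hf
  obtain ⟨M, hM⟩ := isCompact_Icc.exists_bound_of_continuousOn (s := Icc 0 T) hfc.continuousOn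
  refine ⟨|M|, abs_nonneg _, fun t ht htT => ?_⟩
  rw [hf t ht, abs_mul, abs_of_pos (Real.rpow_pos_of_pos ht p), mul_comm]
  exact mul_le_mul_of_nonneg_right ((hM t ⟨ht.le, htT⟩).trans (le_abs_self M))
    (Real.rpow_nonneg ht.le p)

end HasPowRep

/-! ### Beta integrals and Laplace convolution. -/

theorem intervalIntegrable_sub_rpow_mul_rpow {p q : ℝ} (hp : -1 < p) (hq : -1 < q) {t : ℝ}
    (ht : 0 < t) : IntervalIntegrable (fun τ => (t - τ) ^ p * τ ^ q) volume 0 t := by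
  -- Only the singularity at 0 matters on [0, t/2], so p is arbitrary here; the other half follows
  -- by the reflection τ ↦ t - τ with exponents swapped.
  have key : ∀ {p q : ℝ}, -1 < q →
      IntervalIntegrable (fun τ => (t - τ) ^ p * τ ^ q) volume 0 (t / 2) := by
    intro p q hq
    refine (intervalIntegral.intervalIntegrable_rpow' hq).continuousOn_mul ?_
    refine (continuousOn_const.sub continuousOn_id).rpow_const fun τ hτ => Or.inl ?_
    rw [uIcc_of_le (by linarith)] at hτ
    have := hτ.2
    exact ne_of_gt (by simpa using by linarith)
  refine (key hq).trans ?_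
  have h := ((key (p := q) (q := p) hp).comp_sub_left t).symm
  simp only [sub_zero, sub_sub_cancel, sub_half] at h
  exact h.congr fun τ _ => mul_comm _ _

theorem integral_sub_rpow_mul_rpow {a b : ℝ} (ha : 0 < a) (hb : 0 < b) {t : ℝ} (ht : 0 < t) :
    ∫ τ in (0 : ℝ)..t, (t - τ) ^ (a - 1) * τ ^ (b - 1) =
      t ^ (a + b - 1) * (Real.Gamma a * Real.Gamma b / Real.Gamma (a + b)) := by
  have h := Complex.betaIntegral_scaled (b : ℂ) (a : ℂ) ht
  rw [Complex.betaIntegral_eq_Gamma_mul_div _ _ (by simpa) (by simpa)] at h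
  have h2 : ∫ x in (0 : ℝ)..t, (x : ℂ) ^ ((b : ℂ) - 1) * ((t : ℂ) - x) ^ ((a : ℂ) - 1) =
      ((∫ τ in (0 : ℝ)..t, (t - τ) ^ (a - 1) * τ ^ (b - 1) : ℝ) : ℂ) := by
    rw [← intervalIntegral.integral_ofReal]
    refine intervalIntegral.integral_congr fun x hx => ?_
    rw [uIcc_of_le ht.le] at hx
    rw [Complex.ofReal_mul, Complex.ofReal_cpow (sub_nonneg.2 hx.2), Complex.ofReal_cpow hx.1]
    push_cast
    ring
  rw [h2, ← Complex.ofReal_add, Complex.Gamma_ofReal, Complex.Gamma_ofReal, Complex.Gamma_ofReal]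
    at h
  have h3 : ((t : ℂ) ^ (((b + a : ℝ) : ℂ) - 1)) = ((t ^ (b + a - 1) : ℝ) : ℂ) := by
    rw [Complex.ofReal_cpow ht.le]; push_cast; ring
  rw [h3] at h
  have h4 : ∫ τ in (0 : ℝ)..t, (t - τ) ^ (a - 1) * τ ^ (b - 1) =
      t ^ (b + a - 1) * (Real.Gamma b * Real.Gamma a / Real.Gamma (b + a)) := by
    exact_mod_cast h
  rw [h4, add_comm b a, mul_comm (Real.Gamma b)]

theorem intervalIntegral_congr_of_pos {f g : ℝ → ℝ} {t : ℝ} (ht : 0 < t)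
    (h : ∀ τ, 0 < τ → τ < t → f τ = g τ) : ∫ τ in (0 : ℝ)..t, f τ = ∫ τ in (0 : ℝ)..t, g τ := by
  rw [intervalIntegral.integral_of_le ht.le, intervalIntegral.integral_of_le ht.le,
    integral_Ioc_eq_integral_Ioo, integral_Ioc_eq_integral_Ioo]
  exact setIntegral_congr_fun measurableSet_Ioo fun τ hτ => h τ hτ.1 hτ.2

theorem intervalIntegrable_congr_of_pos {f g : ℝ → ℝ} {t : ℝ} (ht : 0 < t)
    (hf : IntervalIntegrable f volume 0 t)
    (h : ∀ τ, 0 < τ → τ < t → f τ = g τ) : IntervalIntegrable g volume 0 t := by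
  rw [intervalIntegrable_iff_integrableOn_Ioo_of_le ht.le] at hf ⊢
  exact hf.congr_fun (fun τ hτ => h τ hτ.1 hτ.2) measurableSet_Ioo

theorem conv_congr {f f' g g' : ℝ → ℝ} (hf : ∀ t, 0 < t → f t = f' t)
    (hg : ∀ t, 0 < t → g t = g' t) {t : ℝ} (ht : 0 < t) : conv f g t = conv f' g' t :=
  intervalIntegral_congr_of_pos ht fun τ h0 h1 => by
    rw [hf _ (sub_pos.2 h1), hg _ h0]

theorem conv_comm (f g : ℝ → ℝ) (t : ℝ) : conv f g t = conv g f t := by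
  unfold conv
  have h := intervalIntegral.integral_comp_sub_left (fun τ => f (t - τ) * g τ) t (a := 0) (b := t)
  simp only [sub_sub_cancel, sub_self, sub_zero] at h
  rw [← h]
  simp_rw [mul_comm]

theorem intervalIntegrable_conv {f g : ℝ → ℝ} (hf : f ∈ CMinusOne) (hg : g ∈ CMinusOne) {t : ℝ}
    (ht : 0 < t) : IntervalIntegrable (fun τ => f (t - τ) * g τ) volume 0 t := by
  obtain ⟨p, hp, f₁, hfc, hf⟩ := mem_CMinusOne_iff.1 hf
  obtain ⟨q, hq, g₁, hgc, hg⟩ := mem_CMinusOne_iff.1 hg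
  refine intervalIntegrable_congr_of_pos ht
    ((intervalIntegrable_sub_rpow_mul_rpow hp hq ht).mul_continuousOn
      (g := fun τ => f₁ (t - τ) * g₁ τ) (by fun_prop)) fun τ h0 h1 => ?_
  rw [hf _ (sub_pos.2 h1), hg _ h0]
  ring

/-- The substitution τ = tu pulls out t^{p+q+1}; the remaining integral over [0,1] is continuous in
t by dominated convergence, the Beta weight being integrable. -/
theorem HasPowRep.conv {p q : ℝ} {f g : ℝ → ℝ} (hf : HasPowRep p f) (hg : HasPowRep q g)
    (hp : -1 < p) (hq : -1 < q) : HasPowRep (p + q + 1) (conv f g) := by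
  obtain ⟨f₁, hfc, hf⟩ := hf
  obtain ⟨g₁, hgc, hg⟩ := hg
  refine ⟨fun t => ∫ u in (0 : ℝ)..1, (1 - u) ^ p * u ^ q * (f₁ (t * (1 - u)) * g₁ (t * u)),
    ?_, fun t ht => ?_⟩
  · have hmeas : AEStronglyMeasurable (fun u : ℝ => (1 - u) ^ p * u ^ q)
        (volume.restrict (uIoc (0 : ℝ) 1)) :=
      (intervalIntegrable_sub_rpow_mul_rpow hp hq one_pos).def'.aestronglyMeasurable
    rw [continuous_iff_continuousAt]
    intro t₀
    let K : Set (ℝ × ℝ) := Icc (t₀ - 1) (t₀ + 1) ×ˢ Icc 0 1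
    have hcont : Continuous fun x : ℝ × ℝ => f₁ (x.1 * (1 - x.2)) * g₁ (x.1 * x.2) := by fun_prop
    obtain ⟨M, hM⟩ := (isCompact_Icc.prod isCompact_Icc : IsCompact K).exists_bound_of_continuousOn
      hcont.continuousOn
    refine intervalIntegral.continuousAt_of_dominated_interval
      (bound := fun u => (1 - u) ^ p * u ^ q * M) ?_ ?_
      ((intervalIntegrable_sub_rpow_mul_rpow hp hq one_pos).mul_const M) ?_
    · refine Eventually.of_forall fun t => hmeas.mul ?_
      exact (Continuous.aestronglyMeasurable (by fun_prop))
    · filter_upwards [Icc_mem_nhds (sub_one_lt t₀) (lt_add_one t₀)] with t ht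
      refine ae_of_all _ fun u hu => ?_
      rw [uIoc_of_le zero_le_one] at hu
      have h1 : 0 ≤ (1 - u) ^ p * u ^ q :=
        mul_nonneg (Real.rpow_nonneg (sub_nonneg.2 hu.2) p) (Real.rpow_nonneg hu.1.le q)
      rw [norm_mul, Real.norm_of_nonneg h1]
      exact mul_le_mul_of_nonneg_left (hM (t, u) ⟨ht, hu.1.le, hu.2⟩) h1
    · exact ae_of_all _ fun u _ => by fun_prop
  · have h := intervalIntegral.smul_integral_comp_mul_left
      (fun τ => f (t - τ) * g τ) t (a := 0) (b := 1)
    simp only [mul_zero, mul_one] at h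
    rw [GenFrac.conv, ← h, smul_eq_mul, ← intervalIntegral.integral_const_mul,
      ← intervalIntegral.integral_const_mul]
    refine intervalIntegral_congr_of_pos one_pos fun u h0 h1 => ?_
    have h1' : 0 < 1 - u := sub_pos.2 h1
    have e : t - t * u = t * (1 - u) := by ring
    rw [e, hf _ (mul_pos ht h1'), hg _ (mul_pos ht h0), Real.mul_rpow ht.le h1'.le,
      Real.mul_rpow ht.le h0.le, Real.rpow_add ht, Real.rpow_add ht, Real.rpow_one]
    ring

/-! ### C_{-1} as an algebra under convolution. -/

section CMinusOne

variable {f g h : ℝ → ℝ}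

theorem CMinusOne_congr (hf : f ∈ CMinusOne) (h : ∀ t, 0 < t → g t = f t) : g ∈ CMinusOne := by
  obtain ⟨p, hp, hf⟩ := mem_CMinusOne_iff.1 hf
  exact (hf.congr h).mem hp

theorem CMinusOne_add (hf : f ∈ CMinusOne) (hg : g ∈ CMinusOne) :
    (fun t => f t + g t) ∈ CMinusOne := by
  obtain ⟨p, hp, hf⟩ := mem_CMinusOne_iff.1 hf
  obtain ⟨q, hq, hg⟩ := mem_CMinusOne_iff.1 hg
  exact ((hf.mono (min_le_left p q)).add (hg.mono (min_le_right p q))).mem (lt_min hp hq)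

theorem CMinusOne_const_mul (c : ℝ) (hf : f ∈ CMinusOne) : (fun t => c * f t) ∈ CMinusOne := by
  obtain ⟨p, hp, hf⟩ := mem_CMinusOne_iff.1 hf
  exact (hf.const_mul c).mem hp

theorem CMinusOne_of_continuousOn (hf : ContinuousOn f (Ici 0)) : f ∈ CMinusOne :=
  ⟨0, by norm_num, f, hf, fun t _ => by simp⟩

theorem CMinusOne_const (c : ℝ) : (fun _ : ℝ => c) ∈ CMinusOne :=
  CMinusOne_of_continuousOn continuousOn_const

theorem CMinusOne_sum {ι : Type*} (s : Finset ι) {F : ι → ℝ → ℝ} (hF : ∀ i ∈ s, F i ∈ CMinusOne) :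
    (fun t => ∑ i ∈ s, F i t) ∈ CMinusOne := by
  classical
  induction s using Finset.induction_on with
  | empty => simpa using CMinusOne_const 0
  | insert i s hi ih =>
    simp_rw [Finset.sum_insert hi]
    exact CMinusOne_add (hF i (Finset.mem_insert_self i s))
      (ih fun j hj => hF j (Finset.mem_insert_of_mem hj))

theorem CMinusOne_abs (hf : f ∈ CMinusOne) : (fun t => |f t|) ∈ CMinusOne := by
  obtain ⟨p, hp, hf⟩ := mem_CMinusOne_iff.1 hf
  exact hf.abs.mem hp

theorem CMinusOne_conv (hf : f ∈ CMinusOne) (hg : g ∈ CMinusOne) : conv f g ∈ CMinusOne := by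
  obtain ⟨p, hp, hf⟩ := mem_CMinusOne_iff.1 hf
  obtain ⟨q, hq, hg⟩ := mem_CMinusOne_iff.1 hg
  exact (hf.conv hg hp hq).mem (by linarith)

theorem continuousOn_of_mem_CMinusOne (hf : f ∈ CMinusOne) : ContinuousOn f (Ioi 0) := by
  obtain ⟨p, hp, hf⟩ := mem_CMinusOne_iff.1 hf
  exact hf.continuousOn

theorem conv_add_right (hf : f ∈ CMinusOne) (hg : g ∈ CMinusOne) (hh : h ∈ CMinusOne) {t : ℝ}
    (ht : 0 < t) : conv f (fun s => g s + h s) t = conv f g t + conv f h t := by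
  unfold conv
  rw [← intervalIntegral.integral_add (intervalIntegrable_conv hf hg ht)
    (intervalIntegrable_conv hf hh ht)]
  simp_rw [mul_add]

theorem conv_const_mul_right (f g : ℝ → ℝ) (c t : ℝ) :
    conv f (fun s => c * g s) t = c * conv f g t := by
  unfold conv
  rw [← intervalIntegral.integral_const_mul]
  congr 1; ext τ; ring

theorem conv_sum_right {ι : Type*} (s : Finset ι) {F : ι → ℝ → ℝ} (hf : f ∈ CMinusOne)
    (hF : ∀ i ∈ s, F i ∈ CMinusOne) {t : ℝ} (ht : 0 < t) :
    conv f (fun r => ∑ i ∈ s, F i r) t = ∑ i ∈ s, conv f (F i) t := by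
  unfold conv
  rw [← intervalIntegral.integral_finsetSum fun i hi => intervalIntegrable_conv hf (hF i hi) ht]
  simp_rw [Finset.mul_sum]

/-- Extension by zero turns Laplace convolution into convolution on ℝ, from which associativity is
inherited. -/
theorem indicator_conv_eq (f g : ℝ → ℝ) :
    indicator (Ioi 0) (conv f g) =
      convolution (indicator (Ioi 0) f) (indicator (Ioi 0) g) (ContinuousLinearMap.mul ℝ ℝ)
        volume := by
  rw [← posConvolution_eq_convolution_indicator f g _ volume, posConvolution]
  congr 1
  ext t
  rw [conv_comm]
  simp [conv, mul_comm]

theorem convolutionExistsAt_indicator (hf : f ∈ CMinusOne) (hg : g ∈ CMinusOne) (t : ℝ) :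
    ConvolutionExistsAt (indicator (Ioi 0) f) (indicator (Ioi 0) g) t
      (ContinuousLinearMap.mul ℝ ℝ) volume := by
  unfold ConvolutionExistsAt
  have e : (fun τ => (ContinuousLinearMap.mul ℝ ℝ) (indicator (Ioi 0) f τ)
      (indicator (Ioi 0) g (t - τ))) = indicator (Ioo 0 t) (fun τ => g (t - τ) * f τ) := by
    ext τ
    by_cases h0 : 0 < τ <;> by_cases h1 : τ < t <;> simp [h0, h1, indicator, mul_comm]
  rw [e, integrable_indicator_iff measurableSet_Ioo]
  rcases le_or_gt t 0 with ht | ht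
  · simp [Ioo_eq_empty (not_lt.2 ht)]
  · rw [← intervalIntegrable_iff_integrableOn_Ioo_of_le ht.le]
    exact intervalIntegrable_conv hg hf ht

theorem aestronglyMeasurable_indicator (hf : f ∈ CMinusOne) :
    AEStronglyMeasurable (indicator (Ioi 0) f) volume :=
  (aestronglyMeasurable_indicator_iff measurableSet_Ioi).2
    ((continuousOn_of_mem_CMinusOne hf).aestronglyMeasurable measurableSet_Ioi)

theorem conv_assoc (hf : f ∈ CMinusOne) (hg : g ∈ CMinusOne) (hh : h ∈ CMinusOne) {t : ℝ}
    (ht : 0 < t) : conv (conv f g) h t = conv f (conv g h) t := by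
  have norm_ind : ∀ f : ℝ → ℝ, (fun x => ‖indicator (Ioi 0) f x‖) =
      indicator (Ioi 0) fun x => |f x| := fun f => by
    ext x
    exact norm_indicator_eq_indicator_norm f x
  have key := convolution_assoc (ContinuousLinearMap.mul ℝ ℝ) (ContinuousLinearMap.mul ℝ ℝ)
    (ContinuousLinearMap.mul ℝ ℝ) (ContinuousLinearMap.mul ℝ ℝ) (ν := volume) (μ := volume)
    (fun x y z => mul_assoc x y z) (x₀ := t)
    (aestronglyMeasurable_indicator hf) (aestronglyMeasurable_indicator hg)
    (aestronglyMeasurable_indicator hh)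
    (ae_of_all _ fun y => convolutionExistsAt_indicator hf hg y)
    (ae_of_all _ fun y => by
      rw [norm_ind, norm_ind]
      exact convolutionExistsAt_indicator (CMinusOne_abs hg) (CMinusOne_abs hh) y)
    (by
      rw [norm_ind, norm_ind, norm_ind, ← indicator_conv_eq]
      exact convolutionExistsAt_indicator (CMinusOne_abs hf)
        (CMinusOne_conv (CMinusOne_abs hg) (CMinusOne_abs hh)) t)
  rw [← indicator_conv_eq, ← indicator_conv_eq, ← indicator_conv_eq, ← indicator_conv_eq] at key
  simpa [indicator, ht] using key

end CMinusOne

/-! ### Primitives as convolution with 1. -/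

/-- The primitive `t ↦ ∫₀ᵗ g`, as a convolution with the constant function `1`. -/
noncomputable def prim (g : ℝ → ℝ) : ℝ → ℝ := conv (fun _ => 1) g

section prim

variable {f g : ℝ → ℝ}

theorem prim_apply (g : ℝ → ℝ) (t : ℝ) : prim g t = ∫ τ in (0 : ℝ)..t, g τ := by
  simp [prim, conv]

theorem prim_congr (h : ∀ t, 0 < t → f t = g t) {t : ℝ} (ht : 0 < t) : prim f t = prim g t :=
  conv_congr (fun _ _ => rfl) h ht

theorem prim_mem (hg : g ∈ CMinusOne) : prim g ∈ CMinusOne :=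
  CMinusOne_conv (CMinusOne_const 1) hg

theorem hasDerivAt_prim (hg : g ∈ CMinusOne) {t : ℝ} (ht : 0 < t) :
    HasDerivAt (prim g) (g t) t := by
  have hint : IntervalIntegrable g volume 0 t := by
    simpa using intervalIntegrable_conv (CMinusOne_const 1) hg ht
  have hc := continuousOn_of_mem_CMinusOne hg
  have h := intervalIntegral.integral_hasDerivAt_right hint
    (hc.stronglyMeasurableAtFilter isOpen_Ioi t ht) (hc.continuousAt (Ioi_mem_nhds ht))
  exact h.congr_of_eventuallyEq (Eventually.of_forall fun s => prim_apply g s)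

/-- Convolution with 1 raises the exponent q > -1 to q + 1 > 0. -/
theorem tendsto_prim_zero (hg : g ∈ CMinusOne) : Tendsto (prim g) (𝓝[>] 0) (𝓝 0) := by
  obtain ⟨q, hq, hg⟩ := mem_CMinusOne_iff.1 hg
  have h1 : HasPowRep 0 (fun _ => (1 : ℝ)) := ⟨fun _ => 1, continuous_const, fun t _ => by simp⟩
  obtain ⟨φ, hφ, h⟩ := h1.conv hg (by norm_num) hq
  have hpos : 0 < 0 + q + 1 := by linarith
  have hc : Continuous fun t : ℝ => t ^ (0 + q + 1) * φ t :=
    (Real.continuous_rpow_const hpos.le).mul hφ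
  have hlim := (hc.tendsto 0).mono_left (nhdsWithin_le_nhds (s := Ioi 0))
  rw [Real.zero_rpow hpos.ne', zero_mul] at hlim
  refine hlim.congr' ?_
  filter_upwards [self_mem_nhdsWithin] with t ht
  exact (h t ht).symm

theorem eq_of_prim_eq (hf : f ∈ CMinusOne) (hg : g ∈ CMinusOne)
    (h : ∀ t, 0 < t → prim f t = prim g t) {t : ℝ} (ht : 0 < t) : f t = g t := by
  refine (hasDerivAt_prim hf ht).unique ((hasDerivAt_prim hg ht).congr_of_eventuallyEq ?_)
  filter_upwards [Ioi_mem_nhds ht] with s hs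
  exact h s hs

theorem exists_eq_const_of_hasDerivAt_zero {v : ℝ → ℝ} (h : ∀ t, 0 < t → HasDerivAt v 0 t) :
    ∃ c, ∀ t, 0 < t → v t = c := by
  obtain ⟨c, hc⟩ := isOpen_Ioi.exists_is_const_of_deriv_eq_zero isPreconnected_Ioi
    (fun t ht => (h t ht).differentiableAt.differentiableWithinAt) fun t ht => (h t ht).deriv
  exact ⟨c, hc⟩

theorem exists_eq_const_add_prim (hg : g ∈ CMinusOne)
    (h : ∀ t, 0 < t → HasDerivAt f (g t) t) : ∃ c, ∀ t, 0 < t → f t = c + prim g t := by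
  obtain ⟨c, hc⟩ := exists_eq_const_of_hasDerivAt_zero (v := fun t => f t - prim g t)
    fun t ht => by simpa using (h t ht).fun_sub (hasDerivAt_prim hg ht)
  exact ⟨c, fun t ht => by rw [← hc t ht]; ring⟩

theorem prim_conv (hf : f ∈ CMinusOne) (hg : g ∈ CMinusOne) {t : ℝ} (ht : 0 < t) :
    conv (prim f) g t = prim (conv f g) t :=
  conv_assoc (CMinusOne_const 1) hf hg ht

theorem conv_prim (hf : f ∈ CMinusOne) (hg : g ∈ CMinusOne) {t : ℝ} (ht : 0 < t) :
    conv f (prim g) t = prim (conv f g) t := by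
  rw [conv_comm, prim_conv hg hf ht]
  exact prim_congr (fun s _ => conv_comm g f s) ht

theorem prim_iterate_mem (hg : g ∈ CMinusOne) (m : ℕ) : prim^[m] g ∈ CMinusOne := by
  induction m with
  | zero => exact hg
  | succ m ih => rw [Function.iterate_succ_apply']; exact prim_mem ih

theorem prim_iterate_conv (hf : f ∈ CMinusOne) (hg : g ∈ CMinusOne) (m : ℕ) {t : ℝ}
    (ht : 0 < t) : conv (prim^[m] f) g t = prim^[m] (conv f g) t := by
  induction m generalizing t with
  | zero => rfl
  | succ m ih =>
    rw [Function.iterate_succ_apply', Function.iterate_succ_apply',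
      prim_conv (prim_iterate_mem hf m) hg ht]
    exact prim_congr (fun s hs => ih hs) ht

theorem prim_pow_div_factorial (m : ℕ) (t : ℝ) :
    prim (fun s => s ^ m / (m.factorial : ℝ)) t = t ^ (m + 1) / ((m + 1).factorial : ℝ) := by
  rw [prim_apply, intervalIntegral.integral_div, integral_pow, Nat.factorial_succ]
  have : (m.factorial : ℝ) ≠ 0 := by positivity
  push_cast
  simp
  field_simp

theorem prim_iterate_one (m : ℕ) (t : ℝ) :
    prim^[m] (fun _ => 1) t = t ^ m / (m.factorial : ℝ) := by
  induction m generalizing t with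
  | zero => simp
  | succ m ih =>
    rw [Function.iterate_succ_apply', ← prim_pow_div_factorial, funext ih]

end prim

/-! ### Iterated derivatives and primitives on (0,∞). -/

theorem iteratedDeriv_congr_of_pos {f g : ℝ → ℝ} (h : ∀ t, 0 < t → f t = g t) (m : ℕ) {t : ℝ}
    (ht : 0 < t) : iteratedDeriv m f t = iteratedDeriv m g t :=
  EqOn.iteratedDeriv_of_isOpen (s := Ioi 0) (fun s hs => h s hs) isOpen_Ioi m ht

/-- Serves two chains G_{m+1} = G_m': the iterated primitives, and the successive derivatives of the
resolvent. -/
theorem iteratedDeriv_eq_of_hasDerivAt {N : ℕ} {G : ℕ → ℝ → ℝ}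
    (h : ∀ m < N, ∀ t, 0 < t → HasDerivAt (G m) (G (m + 1) t) t) {m : ℕ} (hm : m ≤ N) {t : ℝ}
    (ht : 0 < t) : iteratedDeriv m (G 0) t = G m t := by
  induction m generalizing t with
  | zero => simp
  | succ m ih =>
    rw [iteratedDeriv_succ]
    refine HasDerivAt.deriv ((h m hm t ht).congr_of_eventuallyEq ?_)
    filter_upwards [Ioi_mem_nhds ht] with s hs
    exact ih (Nat.le_of_succ_le hm) hs

theorem contDiffOn_of_hasDerivAt {N : ℕ} {G : ℕ → ℝ → ℝ}
    (h : ∀ m < N, ∀ t, 0 < t → HasDerivAt (G m) (G (m + 1) t) t)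
    (hc : ContinuousOn (G N) (Ioi 0)) : ContDiffOn ℝ (N : WithTop ℕ∞) (G 0) (Ioi 0) := by
  induction N generalizing G with
  | zero => simpa using hc
  | succ N ih =>
    have h0 := h 0 N.succ_pos
    push_cast
    rw [contDiffOn_succ_iff_deriv_of_isOpen isOpen_Ioi]
    refine ⟨fun t ht => (h0 t ht).differentiableAt.differentiableWithinAt, by simp, ?_⟩
    exact (ih (G := fun m => G (m + 1)) (fun m hm => h (m + 1) (by omega)) hc).congr
      fun t ht => (h0 t ht).deriv

theorem hasDerivAt_iteratedDeriv {N m : ℕ} {u : ℝ → ℝ}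
    (hu : ContDiffOn ℝ (N : WithTop ℕ∞) u (Ioi 0)) (hm : m < N) {t : ℝ} (ht : 0 < t) :
    HasDerivAt (iteratedDeriv m u) (iteratedDeriv (m + 1) u t) t := by
  have h := hu.differentiableOn_iteratedDerivWithin (by exact_mod_cast hm) isOpen_Ioi.uniqueDiffOn
  have h2 := h.congr fun s hs => (iteratedDerivWithin_of_isOpen isOpen_Ioi hs).symm
  rw [iteratedDeriv_succ]
  exact (h2.differentiableAt (Ioi_mem_nhds ht)).hasDerivAt

section iterate

variable {g : ℝ → ℝ}

theorem hasDerivAt_prim_iterate (hg : g ∈ CMinusOne) (n : ℕ) :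
    ∀ m < n, ∀ t, 0 < t → HasDerivAt (prim^[n - m] g) (prim^[n - (m + 1)] g t) t := by
  intro m hm t ht
  obtain ⟨r, hr⟩ : ∃ r, n - m = r + 1 := ⟨n - m - 1, by omega⟩
  rw [hr, show n - (m + 1) = r by omega, Function.iterate_succ']
  exact hasDerivAt_prim (prim_iterate_mem hg r) ht

theorem contDiffOn_prim_iterate (hg : g ∈ CMinusOne) (n : ℕ) :
    ContDiffOn ℝ (n : WithTop ℕ∞) (prim^[n] g) (Ioi 0) :=
  contDiffOn_of_hasDerivAt (G := fun m => prim^[n - m] g) (hasDerivAt_prim_iterate hg n)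
    (continuousOn_of_mem_CMinusOne (prim_iterate_mem hg _))

theorem iteratedDeriv_prim_iterate (hg : g ∈ CMinusOne) {n m : ℕ} (hm : m ≤ n) {t : ℝ}
    (ht : 0 < t) : iteratedDeriv m (prim^[n] g) t = prim^[n - m] g t :=
  iteratedDeriv_eq_of_hasDerivAt (G := fun m => prim^[n - m] g) (hasDerivAt_prim_iterate hg n)
    hm ht

theorem tendsto_iteratedDeriv_prim_iterate (hg : g ∈ CMinusOne) {n m : ℕ} (hm : m < n) :
    Tendsto (iteratedDeriv m (prim^[n] g)) (𝓝[>] 0) (𝓝 0) := by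
  obtain ⟨r, hr⟩ : ∃ r, n - m = r + 1 := ⟨n - m - 1, by omega⟩
  refine (tendsto_prim_zero (prim_iterate_mem hg r)).congr' ?_
  filter_upwards [self_mem_nhdsWithin] with t ht
  rw [iteratedDeriv_prim_iterate hg hm.le ht, hr, Function.iterate_succ_apply']

end iterate

theorem eq_zero_of_iteratedDeriv_eq_zero {n : ℕ} {v : ℝ → ℝ}
    (hv : ContDiffOn ℝ (n : WithTop ℕ∞) v (Ioi 0)) (hn : ∀ t, 0 < t → iteratedDeriv n v t = 0)
    (h0 : ∀ i < n, Tendsto (iteratedDeriv i v) (𝓝[>] 0) (𝓝 0)) {t : ℝ} (ht : 0 < t) :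
    v t = 0 := by
  -- Descent on the order: once a derivative vanishes, the one below it is constant, and its limit
  -- at 0 makes that constant zero.
  have key : ∀ j, j ≤ n → ∀ t, 0 < t → iteratedDeriv (n - j) v t = 0 := by
    intro j
    induction j with
    | zero => exact fun _ => hn
    | succ j ih =>
      intro hj
      have hlt : n - (j + 1) < n := by omega
      obtain ⟨c, hc⟩ := exists_eq_const_of_hasDerivAt_zero
        (v := iteratedDeriv (n - (j + 1)) v) fun t ht => by
          have h := hasDerivAt_iteratedDeriv hv hlt ht
          rwa [show n - (j + 1) + 1 = n - j by omega, ih (by omega) t ht] at h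
      have hlim : Tendsto (iteratedDeriv (n - (j + 1)) v) (𝓝[>] 0) (𝓝 c) := by
        refine tendsto_const_nhds.congr' ?_
        filter_upwards [self_mem_nhdsWithin] with t ht
        exact (hc t ht).symm
      intro t ht
      rw [hc t ht, tendsto_nhds_unique hlim (h0 _ hlt)]
  simpa using key n le_rfl t ht

/-! ### Taylor formula with initial values at 0+. -/

section polynomial

/-- The polynomial `∑ a_i t ^ i / i!`. -/
noncomputable def taylorPoly {n : ℕ} (a : Fin n → ℝ) (t : ℝ) : ℝ :=
  ∑ i : Fin n, a i * (t ^ (i : ℕ) / ((i : ℕ).factorial : ℝ))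

variable {n : ℕ} (a : Fin n → ℝ)

theorem contDiff_taylorPoly {m : WithTop ℕ∞} : ContDiff ℝ m (taylorPoly a) := by
  unfold taylorPoly
  fun_prop

theorem iteratedDeriv_taylorPoly (m : ℕ) (t : ℝ) :
    iteratedDeriv m (taylorPoly a) t =
      ∑ i : Fin n, a i * (((i : ℕ).descFactorial m * t ^ ((i : ℕ) - m)) /
        ((i : ℕ).factorial : ℝ)) := by
  have h : ∀ i ∈ (Finset.univ : Finset (Fin n)), ContDiffAt ℝ m
      (fun t : ℝ => a i * (t ^ (i : ℕ) / ((i : ℕ).factorial : ℝ))) t := fun i _ => by fun_prop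
  unfold taylorPoly
  rw [iteratedDeriv_fun_sum h]
  refine Finset.sum_congr rfl fun i _ => ?_
  rw [iteratedDeriv_const_mul_field, iteratedDeriv_div_const, iteratedDeriv_pow]

theorem iteratedDeriv_taylorPoly_self (t : ℝ) : iteratedDeriv n (taylorPoly a) t = 0 := by
  rw [iteratedDeriv_taylorPoly]
  refine Finset.sum_eq_zero fun i _ => ?_
  rw [Nat.descFactorial_of_lt i.2]
  simp

theorem iteratedDeriv_taylorPoly_zero (j : Fin n) :
    iteratedDeriv (j : ℕ) (taylorPoly a) 0 = a j := by
  rw [iteratedDeriv_taylorPoly, Finset.sum_eq_single j]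
  · rw [Nat.descFactorial_self]
    have : ((j : ℕ).factorial : ℝ) ≠ 0 := by positivity
    simp [this]
  · intro i _ hij
    rcases lt_or_gt_of_ne hij with h | h
    · rw [Nat.descFactorial_of_lt h]
      simp
    · rw [zero_pow (by have : (j : ℕ) < i := h; omega)]
      simp
  · simp

theorem tendsto_iteratedDeriv_taylorPoly (j : Fin n) :
    Tendsto (iteratedDeriv (j : ℕ) (taylorPoly a)) (𝓝[>] 0) (𝓝 (a j)) := by
  have hc : Continuous (iteratedDeriv (j : ℕ) (taylorPoly a)) :=
    (contDiff_taylorPoly a (m := (j : ℕ))).continuous_iteratedDeriv _ le_rfl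
  have h := hc.tendsto 0
  rw [iteratedDeriv_taylorPoly_zero] at h
  exact h.mono_left nhdsWithin_le_nhds

variable {a} {g : ℝ → ℝ}

theorem contDiffAt_of_contDiffOn_Ioi {u : ℝ → ℝ} {N m : ℕ}
    (hu : ContDiffOn ℝ (N : WithTop ℕ∞) u (Ioi 0)) (hm : m ≤ N) {t : ℝ} (ht : 0 < t) :
    ContDiffAt ℝ (m : WithTop ℕ∞) u t :=
  ((hu t ht).contDiffAt (Ioi_mem_nhds ht)).of_le (by exact_mod_cast hm)

theorem contDiffOn_taylorPoly_add (hg : g ∈ CMinusOne) :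
    ContDiffOn ℝ (n : WithTop ℕ∞) (fun t => taylorPoly a t + prim^[n] g t) (Ioi 0) :=
  (contDiff_taylorPoly a).contDiffOn.add (contDiffOn_prim_iterate hg n)

theorem iteratedDeriv_taylorPoly_add (hg : g ∈ CMinusOne) {m : ℕ} (hm : m ≤ n) {t : ℝ}
    (ht : 0 < t) : iteratedDeriv m (fun t => taylorPoly a t + prim^[n] g t) t =
      iteratedDeriv m (taylorPoly a) t + iteratedDeriv m (prim^[n] g) t :=
  iteratedDeriv_fun_add (contDiff_taylorPoly a).contDiffAt
    (contDiffAt_of_contDiffOn_Ioi (contDiffOn_prim_iterate hg n) hm ht)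

theorem iteratedDeriv_taylorPoly_add_self (hg : g ∈ CMinusOne) {t : ℝ} (ht : 0 < t) :
    iteratedDeriv n (fun t => taylorPoly a t + prim^[n] g t) t = g t := by
  rw [iteratedDeriv_taylorPoly_add hg le_rfl ht, iteratedDeriv_taylorPoly_self,
    iteratedDeriv_prim_iterate hg le_rfl ht]
  simp

theorem tendsto_iteratedDeriv_taylorPoly_add (hg : g ∈ CMinusOne) (i : Fin n) :
    Tendsto (iteratedDeriv (i : ℕ) fun t => taylorPoly a t + prim^[n] g t) (𝓝[>] 0)
      (𝓝 (a i)) := by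
  have h := (tendsto_iteratedDeriv_taylorPoly a i).add
    (tendsto_iteratedDeriv_prim_iterate hg i.2)
  rw [add_zero] at h
  refine h.congr' ?_
  filter_upwards [self_mem_nhdsWithin] with t ht
  exact (iteratedDeriv_taylorPoly_add hg i.2.le ht).symm

/-- Taylor's formula with integral remainder: the difference of the two sides has zero n-th
derivative and zero initial values. -/
theorem eq_taylorPoly_add_prim_iterate {u : ℝ → ℝ}
    (hu : ContDiffOn ℝ (n : WithTop ℕ∞) u (Ioi 0)) (hmem : iteratedDeriv n u ∈ CMinusOne)
    (h0 : ∀ i : Fin n, Tendsto (iteratedDeriv (i : ℕ) u) (𝓝[>] 0) (𝓝 (a i))) {t : ℝ}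
    (ht : 0 < t) : u t = taylorPoly a t + prim^[n] (iteratedDeriv n u) t := by
  have hw := contDiffOn_taylorPoly_add (a := a) hmem
  have hsub : ∀ m ≤ n, ∀ t, 0 < t →
      iteratedDeriv m (fun t => u t - (taylorPoly a t + prim^[n] (iteratedDeriv n u) t)) t =
      iteratedDeriv m u t - iteratedDeriv m
        (fun t => taylorPoly a t + prim^[n] (iteratedDeriv n u) t) t := fun m hm t ht =>
    iteratedDeriv_fun_sub (contDiffAt_of_contDiffOn_Ioi hu hm ht)
      (contDiffAt_of_contDiffOn_Ioi hw hm ht)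
  refine sub_eq_zero.1 (eq_zero_of_iteratedDeriv_eq_zero (hu.sub hw) ?_ ?_ ht)
  · intro t ht
    rw [hsub n le_rfl t ht, iteratedDeriv_taylorPoly_add_self hmem ht, sub_self]
  · intro i hi
    have h := (h0 ⟨i, hi⟩).sub (tendsto_iteratedDeriv_taylorPoly_add (a := a) hmem ⟨i, hi⟩)
    rw [sub_self] at h
    refine h.congr' ?_
    filter_upwards [self_mem_nhdsWithin] with t ht
    exact (hsub i hi.le t ht).symm

end polynomial

/-! ### Convergence of the convolution series and the resolvent equation. -/

/-- Restrict Euler's integral to (R,∞), where x^{s-1} ≥ R^{s-1} because s ≥ 1. -/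
theorem rpow_sub_one_mul_exp_neg_le_Gamma {s R : ℝ} (hs : 1 ≤ s) (hR : 0 < R) :
    R ^ (s - 1) * Real.exp (-R) ≤ Real.Gamma s := by
  have hs0 : 0 < s := by linarith
  have hint := Real.GammaIntegral_convergent hs0
  have hsub : Ioi R ⊆ Ioi 0 := Ioi_subset_Ioi hR.le
  rw [Real.Gamma_eq_integral hs0, ← integral_exp_neg_Ioi R, ← integral_const_mul]
  calc ∫ x in Ioi R, R ^ (s - 1) * Real.exp (-x)
      ≤ ∫ x in Ioi R, Real.exp (-x) * x ^ (s - 1) := by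
        refine setIntegral_mono_on ((integrableOn_exp_neg_Ioi R).const_mul _)
          (hint.mono_set hsub) measurableSet_Ioi fun x hx => ?_
        rw [mul_comm]
        exact mul_le_mul_of_nonneg_left (Real.rpow_le_rpow hR.le (le_of_lt hx) (by linarith))
          (Real.exp_pos _).le
    _ ≤ ∫ x in Ioi 0, Real.exp (-x) * x ^ (s - 1) := by
        refine setIntegral_mono_set hint ?_ hsub.eventuallyLE
        filter_upwards [ae_restrict_mem measurableSet_Ioi] with x hx
        exact mul_nonneg (Real.exp_pos _).le (Real.rpow_nonneg (le_of_lt hx) _)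

theorem summable_pow_div_Gamma {a x : ℝ} (ha : 0 < a) (hx : 0 ≤ x) :
    Summable fun j : ℕ => x ^ j / Real.Gamma ((j + 1 : ℕ) * a) := by
  -- R is chosen so that R^a = 2(x+1): the terms are then dominated by a geometric series of ratio
  -- x/(2(x+1)) < 1. The +1 keeps R positive when x = 0.
  set R : ℝ := (2 * (x + 1)) ^ a⁻¹ with hRdef
  have hb : 0 < 2 * (x + 1) := by linarith
  have hR : 0 < R := Real.rpow_pos_of_pos hb _
  have hRa : R ^ a = 2 * (x + 1) := by
    rw [hRdef, ← Real.rpow_mul hb.le, inv_mul_cancel₀ ha.ne', Real.rpow_one]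
  have hgeom : Summable fun j : ℕ => (R ^ (a - 1) * Real.exp (-R))⁻¹ * (x / (2 * (x + 1))) ^ j := by
    refine (summable_geometric_of_lt_one (by positivity) ?_).mul_left _
    rw [div_lt_one hb]
    linarith
  -- From this index on, (j+1)a ≥ 1, as the lower bound for Γ requires.
  obtain ⟨N, hN⟩ := exists_nat_ge (1 / a)
  refine hgeom.of_norm_bounded_eventually_nat ?_
  filter_upwards [eventually_ge_atTop N] with j hj
  have hs : 1 ≤ ((j + 1 : ℕ) : ℝ) * a := by
    have h1 : 1 / a ≤ ((j + 1 : ℕ) : ℝ) :=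
      hN.trans (by exact_mod_cast hj.trans (Nat.le_succ j))
    rwa [div_le_iff₀ ha] at h1
  have hG := rpow_sub_one_mul_exp_neg_le_Gamma hs hR
  have e : R ^ (((j + 1 : ℕ) : ℝ) * a - 1) = (2 * (x + 1)) ^ j * R ^ (a - 1) := by
    rw [← hRa, ← Real.rpow_natCast (R ^ a), ← Real.rpow_mul hR.le, ← Real.rpow_add hR]
    congr 1
    push_cast
    ring
  rw [e] at hG
  have hpos : 0 < (2 * (x + 1)) ^ j * R ^ (a - 1) * Real.exp (-R) := by positivity
  rw [Real.norm_of_nonneg (div_nonneg (pow_nonneg hx j) (hpos.le.trans hG))]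
  calc x ^ j / Real.Gamma (((j + 1 : ℕ) : ℝ) * a)
      ≤ x ^ j / ((2 * (x + 1)) ^ j * R ^ (a - 1) * Real.exp (-R)) :=
        div_le_div_of_nonneg_left (pow_nonneg hx j) hpos hG
    _ = (R ^ (a - 1) * Real.exp (-R))⁻¹ * (x / (2 * (x + 1))) ^ j := by
        rw [div_pow]
        field_simp

section series

variable {κ : ℝ → ℝ} {p : ℝ}

theorem convPow_add_two (κ : ℝ → ℝ) (j : ℕ) :
    convPow κ (j + 2) = conv κ (convPow κ (j + 1)) := rfl

/-- Each convolution with κ adds p + 1 > 0 to the exponent, so the exponent p serves all powers at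
once. -/
theorem HasPowRep.convPow (hκ : HasPowRep p κ) (hp : -1 < p) (j : ℕ) :
    HasPowRep p (convPow κ (j + 1)) := by
  induction j with
  | zero => exact hκ
  | succ j ih => exact (hκ.conv ih hp hp).mono (by linarith)

/-- Equality would hold for κ = M t^p: each induction step is one Beta integral, and its Gamma
quotients telescope. -/
theorem abs_convPow_le (hκ : HasPowRep p κ) (hp : -1 < p) {M T : ℝ} (hM : 0 ≤ M)
    (hb : ∀ t, 0 < t → t ≤ T → |κ t| ≤ M * t ^ p) (j : ℕ) {t : ℝ} (ht : 0 < t) (htT : t ≤ T) :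
    |convPow κ (j + 1) t| ≤ (M * Real.Gamma (p + 1)) ^ (j + 1) /
      Real.Gamma ((j + 1 : ℕ) * (p + 1)) * t ^ (((j + 1 : ℕ) : ℝ) * (p + 1) - 1) := by
  have ha : 0 < p + 1 := by linarith
  have hΓ : 0 < Real.Gamma (p + 1) := Real.Gamma_pos_of_pos ha
  induction j generalizing t with
  | zero =>
    have h := hb t ht htT
    simp only [zero_add, pow_one, Nat.cast_one, one_mul, add_sub_cancel_right]
    rwa [mul_div_assoc, div_self hΓ.ne', mul_one]
  | succ j ih =>
    set b : ℝ := ((j + 1 : ℕ) : ℝ) * (p + 1) with hbdef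
    have hb0 : 0 < b := by positivity
    have hΓb : 0 < Real.Gamma b := Real.Gamma_pos_of_pos hb0
    set C : ℝ := (M * Real.Gamma (p + 1)) ^ (j + 1) / Real.Gamma b with hC
    have hC0 : 0 ≤ C := by positivity
    have hint := intervalIntegrable_sub_rpow_mul_rpow (p := p) (q := b - 1) hp (by linarith) ht
    have hmem := (hκ.convPow hp j).mem hp
    rw [convPow_add_two]
    have e : ((j + 1 + 1 : ℕ) : ℝ) * (p + 1) = p + 1 + b := by
      rw [hbdef]; push_cast; ring
    rw [e]
    calc |conv κ (convPow κ (j + 1)) t|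
        ≤ ∫ τ in (0 : ℝ)..t, |κ (t - τ) * convPow κ (j + 1) τ| :=
          intervalIntegral.abs_integral_le_integral_abs ht.le
      _ ≤ ∫ τ in (0 : ℝ)..t, M * C * ((t - τ) ^ p * τ ^ (b - 1)) := by
          refine intervalIntegral.integral_mono_on_of_le_Ioo ht.le
            (intervalIntegrable_conv (hκ.mem hp) hmem ht).abs (hint.const_mul _) fun τ hτ => ?_
          rw [abs_mul]
          have h1 := hb (t - τ) (sub_pos.2 hτ.2) (by linarith [hτ.1])
          have h2 := ih hτ.1 (hτ.2.le.trans htT)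
          calc |κ (t - τ)| * |convPow κ (j + 1) τ|
              ≤ (M * (t - τ) ^ p) * (C * τ ^ (b - 1)) :=
                mul_le_mul h1 h2 (abs_nonneg _) ((abs_nonneg _).trans h1)
            _ = _ := by ring
      _ = M * C * (t ^ (p + 1 + b - 1) *
            (Real.Gamma (p + 1) * Real.Gamma b / Real.Gamma (p + 1 + b))) := by
          rw [intervalIntegral.integral_const_mul, ← integral_sub_rpow_mul_rpow ha hb0 ht,
            add_sub_cancel_right]
      _ = (M * Real.Gamma (p + 1)) ^ (j + 1 + 1) / Real.Gamma (p + 1 + b) *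
            t ^ (p + 1 + b - 1) := by
          rw [hC, pow_succ _ (j + 1)]
          field_simp

/-- The terms of the convolution series, divided by `t ^ p`, extend to continuous functions on
`[0,∞)` which are summably bounded on bounded intervals. -/
theorem exists_convPow_rep (hκ : HasPowRep p κ) (hp : -1 < p) (lam : ℝ) :
    ∃ φ : ℕ → ℝ → ℝ, (∀ j, Continuous (φ j)) ∧
      (∀ j t, 0 < t → lam ^ j * convPow κ (j + 1) t = t ^ p * φ j t) ∧
      ∀ T, 0 < T → ∃ u : ℕ → ℝ, Summable u ∧ ∀ j, ∀ t ∈ Icc 0 T, |φ j t| ≤ u j := by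
  have ha : 0 < p + 1 := by linarith
  choose φ hφc hφ using fun j => (hκ.convPow hp j).const_mul (lam ^ j)
  beta_reduce at hφ
  refine ⟨φ, hφc, hφ, fun T hT => ?_⟩
  obtain ⟨M, hM, hb⟩ := hκ.exists_abs_le T
  have hA : 0 ≤ M * Real.Gamma (p + 1) := mul_nonneg hM (Real.Gamma_pos_of_pos ha).le
  set A : ℝ := M * Real.Gamma (p + 1) with hAdef
  refine ⟨fun j => A * ((|lam| * A * T ^ (p + 1)) ^ j / Real.Gamma ((j + 1 : ℕ) * (p + 1))),
    (summable_pow_div_Gamma ha (by positivity)).mul_left A, fun j => ?_⟩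
  have hpos : ∀ t ∈ Ioc 0 T, |φ j t| ≤
      A * ((|lam| * A * T ^ (p + 1)) ^ j / Real.Gamma ((j + 1 : ℕ) * (p + 1))) := by
    intro t ht
    have htp : 0 < t ^ p := Real.rpow_pos_of_pos ht.1 p
    have hΓ : 0 < Real.Gamma (((j + 1 : ℕ) : ℝ) * (p + 1)) :=
      Real.Gamma_pos_of_pos (by positivity)
    have h := abs_convPow_le hκ hp hM hb j ht.1 ht.2
    have e : t ^ (((j + 1 : ℕ) : ℝ) * (p + 1) - 1) = t ^ p * (t ^ (p + 1)) ^ j := by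
      rw [← Real.rpow_natCast (t ^ (p + 1)), ← Real.rpow_mul ht.1.le, ← Real.rpow_add ht.1]
      congr 1
      push_cast
      ring
    rw [e, ← hAdef] at h
    have h2 : t ^ p * |φ j t| = |lam| ^ j * |convPow κ (j + 1) t| := by
      rw [← abs_pow, ← abs_mul, hφ j t ht.1, abs_mul, abs_of_pos htp]
    have h3 : (t ^ (p + 1)) ^ j ≤ (T ^ (p + 1)) ^ j :=
      pow_le_pow_left₀ (Real.rpow_nonneg ht.1.le _) (Real.rpow_le_rpow ht.1.le ht.2 ha.le) j
    refine le_of_mul_le_mul_left ?_ htp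
    rw [h2]
    calc |lam| ^ j * |convPow κ (j + 1) t|
        ≤ |lam| ^ j * (A ^ (j + 1) / Real.Gamma (((j + 1 : ℕ) : ℝ) * (p + 1)) *
          (t ^ p * (T ^ (p + 1)) ^ j)) := by
          refine mul_le_mul_of_nonneg_left (h.trans ?_) (by positivity)
          exact mul_le_mul_of_nonneg_left (mul_le_mul_of_nonneg_left h3 htp.le) (by positivity)
      _ = _ := by ring
  -- The power representation says nothing at t = 0; the bound reaches 0 by continuity of φ_j.
  have hcl : IsClosed {t | |φ j t| ≤
      A * ((|lam| * A * T ^ (p + 1)) ^ j / Real.Gamma ((j + 1 : ℕ) * (p + 1)))} :=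
    isClosed_le (hφc j).abs continuous_const
  have h := hcl.closure_subset_iff.2 hpos
  rwa [closure_Ioc hT.ne] at h

theorem summable_convSeries (hκ : κ ∈ CMinusOne) (lam : ℝ) {t : ℝ} (ht : 0 < t) :
    Summable fun j : ℕ => lam ^ j * convPow κ (j + 1) t := by
  obtain ⟨p, hp, hκ⟩ := mem_CMinusOne_iff.1 hκ
  obtain ⟨φ, -, hφ, hb⟩ := exists_convPow_rep hκ hp lam
  obtain ⟨u, hu, hbu⟩ := hb t ht
  have h : Summable fun j => φ j t := hu.of_norm_bounded fun j => hbu j t ⟨ht.le, le_rfl⟩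
  exact (h.mul_left (t ^ p)).congr fun j => (hφ j t ht).symm

theorem convSeries_mem (hκ : κ ∈ CMinusOne) (lam : ℝ) : convSeries κ lam ∈ CMinusOne := by
  obtain ⟨p, hp, hκ⟩ := mem_CMinusOne_iff.1 hκ
  obtain ⟨φ, hφc, hφ, hb⟩ := exists_convPow_rep hκ hp lam
  refine ⟨p, hp, fun t => ∑' j, φ j t, ?_, fun t ht => ?_⟩
  · intro t ht
    have ht' : 0 ≤ t := ht
    obtain ⟨u, hu, hbu⟩ := hb (t + 1) (by linarith)
    have h := continuousOn_tsum (s := Icc 0 (t + 1)) (fun j => (hφc j).continuousOn) hu hbu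
    refine (h t ⟨ht', by linarith⟩).mono_of_mem_nhdsWithin ?_
    rw [← Ici_inter_Iic]
    exact inter_mem self_mem_nhdsWithin (mem_nhdsWithin_of_mem_nhds (Iic_mem_nhds (by linarith)))
  · rw [convSeries, ← tsum_mul_left]
    exact tsum_congr fun j => hφ j t ht

/-- Split off the first term and convolve the series with κ termwise; dominated convergence applies
with the majorants |κ(t-τ)| τ^p u_j. -/
theorem convSeries_eq (hκ : κ ∈ CMinusOne) (lam : ℝ) {t : ℝ} (ht : 0 < t) :
    convSeries κ lam t = κ t + lam * conv κ (convSeries κ lam) t := by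
  have hsum : HasSum (fun j : ℕ => lam ^ j * convPow κ (j + 2) t)
      (conv κ (convSeries κ lam) t) := by
    obtain ⟨p, hp, hrep⟩ := mem_CMinusOne_iff.1 hκ
    obtain ⟨φ, hφc, hφ, hb⟩ := exists_convPow_rep hrep hp lam
    obtain ⟨u, hu, hbu⟩ := hb t ht
    have e : ∀ j : ℕ, lam ^ j * convPow κ (j + 2) t =
        ∫ τ in (0 : ℝ)..t, κ (t - τ) * (lam ^ j * convPow κ (j + 1) τ) := fun j => by
      rw [convPow_add_two]
      exact (conv_const_mul_right κ _ _ t).symm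
    simp_rw [e]
    have hpow : (fun t : ℝ => t ^ p) ∈ CMinusOne :=
      HasPowRep.mem ⟨fun _ => 1, continuous_const, fun t _ => by simp⟩ hp
    refine intervalIntegral.hasSum_integral_of_dominated_convergence
      (fun j τ => |κ (t - τ)| * τ ^ p * u j) (fun j => ?_) (fun j => ?_) ?_ ?_ ?_
    · exact (intervalIntegrable_conv hκ (CMinusOne_const_mul (lam ^ j)
        ((hrep.convPow hp j).mem hp)) ht).def'.aestronglyMeasurable
    · refine ae_of_all _ fun τ hτ => ?_
      rw [uIoc_of_le ht.le] at hτ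
      rw [hφ j τ hτ.1, norm_mul, norm_mul, Real.norm_of_nonneg (Real.rpow_nonneg hτ.1.le p),
        Real.norm_eq_abs, ← mul_assoc]
      exact mul_le_mul_of_nonneg_left (hbu j τ ⟨hτ.1.le, hτ.2⟩)
        (mul_nonneg (abs_nonneg _) (Real.rpow_nonneg hτ.1.le p))
    · exact ae_of_all _ fun τ _ => hu.mul_left _
    · simp_rw [tsum_mul_left]
      exact (intervalIntegrable_conv (CMinusOne_abs hκ) hpow ht).mul_const _
    · refine ae_of_all _ fun τ hτ => ?_
      rw [uIoc_of_le ht.le] at hτ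
      exact (summable_convSeries hκ lam hτ.1).hasSum.mul_left _
  rw [convSeries, (summable_convSeries hκ lam ht).tsum_eq_zero_add, ← hsum.tsum_eq,
    ← tsum_mul_left]
  congr 1
  · simp [convPow]
  · exact tsum_congr fun j => by rw [pow_succ]; ring

end series

/-! ### Volterra equations of the second kind. -/

section conv_left

variable {f g h : ℝ → ℝ} {t : ℝ}

theorem conv_add_left (hf : f ∈ CMinusOne) (hg : g ∈ CMinusOne) (hh : h ∈ CMinusOne)
    (ht : 0 < t) : conv (fun s => f s + g s) h t = conv f h t + conv g h t := by
  rw [conv_comm, conv_add_right hh hf hg ht, conv_comm h f, conv_comm h g]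

theorem conv_const_mul_left (f g : ℝ → ℝ) (c t : ℝ) :
    conv (fun s => c * f s) g t = c * conv f g t := by
  rw [conv_comm, conv_const_mul_right, conv_comm]

theorem conv_zero_left (g : ℝ → ℝ) (t : ℝ) : conv (fun _ => 0) g t = 0 := by
  simp [conv]

theorem prim_add (hf : f ∈ CMinusOne) (hg : g ∈ CMinusOne) (ht : 0 < t) :
    prim (fun s => f s + g s) t = prim f t + prim g t :=
  conv_add_right (CMinusOne_const 1) hf hg ht

theorem prim_const_mul (g : ℝ → ℝ) (c t : ℝ) : prim (fun s => c * g s) t = c * prim g t :=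
  conv_const_mul_right _ g c t

end conv_left

section volterra

variable {κ y w z : ℝ → ℝ} {lam : ℝ}

theorem convSeries_conv (hκ : κ ∈ CMinusOne) (hz : z ∈ CMinusOne) {t : ℝ} (ht : 0 < t) :
    conv (convSeries κ lam) z t = conv κ z t + lam * conv κ (conv (convSeries κ lam) z) t := by
  have hl := convSeries_mem hκ lam
  rw [conv_congr (fun s hs => convSeries_eq hκ lam hs) (fun _ _ => rfl) ht,
    conv_add_left hκ (CMinusOne_const_mul lam (CMinusOne_conv hκ hl)) hz ht, conv_const_mul_left,
    conv_assoc hκ hl hz ht]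

theorem conv_convSeries_comm (hκ : κ ∈ CMinusOne) (hz : z ∈ CMinusOne) {t : ℝ} (ht : 0 < t) :
    conv κ (conv (convSeries κ lam) z) t = conv (convSeries κ lam) (conv κ z) t := by
  have hl := convSeries_mem hκ lam
  rw [← conv_assoc hκ hl hz ht, ← conv_assoc hl hκ hz ht]
  exact conv_congr (fun s _ => conv_comm _ _ s) (fun _ _ => rfl) ht

/-- The Volterra equation of the second kind with kernel `κ` and its resolvent. -/
theorem volterra_iff (hκ : κ ∈ CMinusOne) (hy : y ∈ CMinusOne) (hw : w ∈ CMinusOne) :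
    (∀ t, 0 < t → y t = w t + lam * conv κ y t) ↔
      ∀ t, 0 < t → y t = w t + lam * conv (convSeries κ lam) w t := by
  have hl := convSeries_mem hκ lam
  constructor
  · intro h t ht
    have h1 : conv (convSeries κ lam) y t =
        conv (convSeries κ lam) w t + lam * conv (convSeries κ lam) (conv κ y) t := by
      rw [conv_congr (fun _ _ => rfl) h ht,
        conv_add_right hl hw (CMinusOne_const_mul lam (CMinusOne_conv hκ hy)) ht,
        conv_const_mul_right]
    have h2 := convSeries_conv (lam := lam) hκ hy ht
    rw [conv_convSeries_comm hκ hy ht] at h2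
    -- With l the convolution series, comparing two expressions for l*y, one from the equation for y
    -- and one from the resolvent identity, cancels λ l*(κ*y). No division by λ occurs, so λ = 0 is
    -- included.
    have h3 : conv κ y t = conv (convSeries κ lam) w t := by linarith
    rw [h t ht, h3]
  · intro h t ht
    have h1 : conv κ y t = conv κ w t + lam * conv κ (conv (convSeries κ lam) w) t := by
      rw [conv_congr (fun _ _ => rfl) h ht,
        conv_add_right hκ hw (CMinusOne_const_mul lam (CMinusOne_conv hl hw)) ht,
        conv_const_mul_right]
    rw [h t ht, h1, ← convSeries_conv hκ hw ht]

end volterra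

/-! ### Kernel pairs: consequences of the singularity of k. -/

theorem mem_CMinusOne_of_mem_CMinusOneZero {k : ℝ → ℝ} (hk : k ∈ CMinusOneZero) :
    k ∈ CMinusOne := by
  obtain ⟨p, hp, -, h⟩ := hk
  exact ⟨p, hp, h⟩

theorem HasPowRep.isBigO_one {f : ℝ → ℝ} (h : HasPowRep 0 f) :
    f =O[𝓝[>] (0 : ℝ)] fun _ => (1 : ℝ) := by
  obtain ⟨M, -, hM⟩ := h.exists_abs_le 1
  refine Asymptotics.IsBigO.of_bound M ?_
  have h1 : ∀ᶠ t : ℝ in 𝓝[>] 0, t ≤ 1 :=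
    mem_nhdsWithin_of_mem_nhds (Iic_mem_nhds one_pos)
  filter_upwards [self_mem_nhdsWithin, h1] with t ht ht1
  simpa using hM t ht ht1

/-- A solution in `C_{-1}` of a Volterra equation of the second kind with bounded right-hand side
is bounded near the origin. -/
theorem isBigO_one_of_volterra {k g b : ℝ → ℝ} {c : ℝ} (hc : c ≠ 0) (hk : k ∈ CMinusOne)
    (hg : g ∈ CMinusOne) (hb : HasPowRep 0 b)
    (h : ∀ t, 0 < t → c * k t + conv k g t = b t) : k =O[𝓝[>] (0 : ℝ)] fun _ => (1 : ℝ) := by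
  obtain ⟨p, hp, hk⟩ := mem_CMinusOne_iff.1 hk
  obtain ⟨q, hq, hg⟩ := mem_CMinusOne_iff.1 hg
  -- Bootstrap: solving the equation for k gains q + 1 in the exponent at each pass, capped at 0
  -- because b has exponent 0.
  have key : ∀ N : ℕ, HasPowRep (min 0 (p + N * (q + 1))) k := by
    intro N
    induction N with
    | zero => exact hk.mono (by simp)
    | succ N ih =>
      have hr : -1 < min 0 (p + N * (q + 1)) := by
        refine lt_min (by norm_num) ?_
        have : 0 ≤ (N : ℝ) * (q + 1) := mul_nonneg N.cast_nonneg (by linarith)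
        linarith
      have h1 := (ih.conv hg hr hq).const_mul (-1)
      have hle : min 0 (p + (N + 1 : ℕ) * (q + 1)) ≤ min 0 (p + N * (q + 1)) + q + 1 := by
        push_cast
        rcases min_cases 0 (p + N * (q + 1)) with ⟨e, -⟩ | ⟨e, -⟩ <;> rw [e]
        · exact (min_le_left _ _).trans (by linarith)
        · exact (min_le_right _ _).trans (by linarith)
      refine (((hb.mono (min_le_left _ _)).add (h1.mono hle)).const_mul c⁻¹).congr
        fun t ht => ?_
      rw [← h t ht]
      field_simp
      ring
  obtain ⟨N, hN⟩ := exists_nat_ge (-p / (q + 1))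
  have hpos : 0 ≤ p + N * (q + 1) := by
    rw [div_le_iff₀ (by linarith)] at hN
    linarith
  have h0 := key N
  rw [min_eq_left hpos] at h0
  exact h0.isBigO_one

theorem pow_div_factorial_mem (m : ℕ) : (fun t : ℝ => t ^ m / (m.factorial : ℝ)) ∈ CMinusOne :=
  CMinusOne_of_continuousOn (by fun_prop)

/-- Downward from order N: each derivative is a constant plus the primitive of the next one. -/
theorem iteratedDeriv_mem_CMinusOne {N : ℕ} {κ : ℝ → ℝ} (hκ : κ ∈ CMinusOneDiff N) {i : ℕ}
    (hi : i ≤ N) : iteratedDeriv i κ ∈ CMinusOne := by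
  obtain ⟨-, hcd, hN⟩ := hκ
  induction hi using Nat.decreasingInduction with
  | self => exact hN
  | of_succ i hi ih =>
    obtain ⟨c, hc⟩ := exists_eq_const_add_prim ih fun t ht => hasDerivAt_iteratedDeriv hcd hi ht
    exact CMinusOne_congr (CMinusOne_add (CMinusOne_const c) (prim_mem ih)) hc

section kernel

variable {n : ℕ} {κ k : ℝ → ℝ}

theorem KernelPair.k_mem_CMinusOne (H : KernelPair n κ k) : k ∈ CMinusOne :=
  mem_CMinusOne_of_mem_CMinusOneZero H.k_mem

/-- Here κ = c + ∫κ₁, so k*κ is the primitive of c k + k*κ₁, which must therefore equal t^m/m!. If c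
≠ 0, this Volterra equation would bound k near 0; hence c = 0 and the boundary term disappears. -/
theorem eq_prim_and_conv_of_conv_eq_pow {κ₁ : ℝ → ℝ} {m : ℕ} (hk : k ∈ CMinusOne)
    (hs : ¬ (k =O[𝓝[>] (0 : ℝ)] fun _ => (1 : ℝ))) (hκ₁ : κ₁ ∈ CMinusOne)
    (hd : ∀ t, 0 < t → HasDerivAt κ (κ₁ t) t)
    (h : ∀ t, 0 < t → conv k κ t = t ^ (m + 1) / ((m + 1).factorial : ℝ)) :
    (∀ t, 0 < t → κ t = prim κ₁ t) ∧
      ∀ t, 0 < t → conv k κ₁ t = t ^ m / (m.factorial : ℝ) := by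
  obtain ⟨c, hc⟩ := exists_eq_const_add_prim hκ₁ hd
  have hck : (fun t => c * k t) ∈ CMinusOne := CMinusOne_const_mul c hk
  have hconv := CMinusOne_conv hk hκ₁
  have key : ∀ t, 0 < t → c * k t + conv k κ₁ t = t ^ m / (m.factorial : ℝ) := fun t ht => by
    refine eq_of_prim_eq (CMinusOne_add hck hconv) (pow_div_factorial_mem m) (fun t ht => ?_) ht
    rw [prim_pow_div_factorial, ← h t ht, conv_congr (fun _ _ => rfl) hc ht,
      conv_add_right hk (CMinusOne_const c) (prim_mem hκ₁) ht, conv_prim hk hκ₁ ht,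
      prim_add hck hconv ht, prim_const_mul, conv_comm k (fun _ => c)]
    congr 1
    simpa [prim] using (conv_const_mul_left (fun _ => 1) k c t).symm
  have hc0 : c = 0 := by
    by_contra hne
    refine hs (isBigO_one_of_volterra hne hk hκ₁ ?_ key)
    exact ⟨fun t => t ^ m / (m.factorial : ℝ), by fun_prop, fun t _ => by simp⟩
  subst hc0
  exact ⟨fun t ht => by simpa using hc t ht, fun t ht => by simpa using key t ht⟩

theorem KernelPair.conv_iteratedDeriv (H : KernelPair n κ k) (hκ : κ ∈ CMinusOneDiff (n - 1))
    {i : ℕ} (hi : i ≤ n - 1) {t : ℝ} (ht : 0 < t) :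
    conv k (iteratedDeriv i κ) t = t ^ (n - 1 - i) / ((n - 1 - i).factorial : ℝ) := by
  induction i generalizing t with
  | zero =>
    rw [iteratedDeriv_zero, conv_comm, H.conv_eq t ht, Nat.sub_zero]
  | succ i ih =>
    refine (eq_prim_and_conv_of_conv_eq_pow (κ := iteratedDeriv i κ) H.k_mem_CMinusOne
      H.k_singular (iteratedDeriv_mem_CMinusOne hκ hi)
      (fun t ht => hasDerivAt_iteratedDeriv hκ.2.1 hi ht) fun t ht => ?_).2 t ht
    rw [ih (by omega) ht, show n - 1 - i = n - 1 - (i + 1) + 1 by omega]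

theorem KernelPair.iteratedDeriv_eq_prim (H : KernelPair n κ k) (hκ : κ ∈ CMinusOneDiff (n - 1))
    {i : ℕ} (hi : i < n - 1) {t : ℝ} (ht : 0 < t) :
    iteratedDeriv i κ t = prim (iteratedDeriv (i + 1) κ) t := by
  refine (eq_prim_and_conv_of_conv_eq_pow (m := n - 1 - (i + 1)) H.k_mem_CMinusOne
    H.k_singular (iteratedDeriv_mem_CMinusOne hκ hi)
    (fun t ht => hasDerivAt_iteratedDeriv hκ.2.1 hi ht) fun t ht => ?_).1 t ht
  rw [H.conv_iteratedDeriv hκ hi.le ht, show n - 1 - i = n - 1 - (i + 1) + 1 by omega]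

/-- Since k*κ^{(n-1)} = 1, convolving k*y with κ^{(n-1)} gives the primitive of y, which determines
y. -/
theorem KernelPair.eq_of_conv_eq (H : KernelPair n κ k) (hκ : κ ∈ CMinusOneDiff (n - 1))
    {y z : ℝ → ℝ} (hy : y ∈ CMinusOne) (hz : z ∈ CMinusOne)
    (h : ∀ t, 0 < t → conv k y t = conv k z t) {t : ℝ} (ht : 0 < t) : y t = z t := by
  have hκ' := iteratedDeriv_mem_CMinusOne hκ le_rfl
  have key : ∀ y ∈ CMinusOne, ∀ t, 0 < t →
      prim y t = conv (iteratedDeriv (n - 1) κ) (conv k y) t := fun y hy t ht => by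
    rw [← conv_assoc hκ' H.k_mem_CMinusOne hy ht]
    refine conv_congr (fun s hs => ?_) (fun _ _ => rfl) ht
    rw [conv_comm, H.conv_iteratedDeriv hκ le_rfl hs]
    simp
  refine eq_of_prim_eq hy hz (fun t ht => ?_) ht
  rw [key y hy t ht, key z hz t ht]
  exact conv_congr (fun _ _ => rfl) h ht

theorem KernelPair.conv_conv_eq_prim_iterate (H : KernelPair n κ k) {g : ℝ → ℝ}
    (hg : g ∈ CMinusOne) {t : ℝ} (ht : 0 < t) : conv k (conv κ g) t = prim^[n] g t := by
  rw [← conv_assoc H.k_mem_CMinusOne H.kappa_mem hg ht,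
    conv_congr (f' := prim^[n - 1] fun _ => 1) (g' := g) (fun s hs => ?_) (fun _ _ => rfl) ht,
    prim_iterate_conv (CMinusOne_const 1) hg _ ht]
  -- k*κ accounts for n - 1 primitives of the constant 1, and convolving that 1 with g is the n-th;
  -- `H.one_le` makes the truncated subtraction exact.
  · have e : n = n - 1 + 1 := (Nat.sub_add_cancel H.one_le).symm
    conv_rhs => rw [e]
    rfl
  · rw [conv_comm, H.conv_eq s hs, prim_iterate_one]

/-- In κ^{(m)} * l, with l the convolution series, the derivative falls on the left factor without a
boundary term, because κ^{(m)} is the primitive of κ^{(m+1)} for m < n-1. -/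
theorem KernelPair.hasDerivAt_resolvent (H : KernelPair n κ k) (hκ : κ ∈ CMinusOneDiff (n - 1))
    (lam : ℝ) : ∀ m < n - 1, ∀ t, 0 < t →
      HasDerivAt
        (fun t => iteratedDeriv m κ t + lam * conv (iteratedDeriv m κ) (convSeries κ lam) t)
        (iteratedDeriv (m + 1) κ t +
          lam * conv (iteratedDeriv (m + 1) κ) (convSeries κ lam) t) t := by
  intro m hm t ht
  have hl := convSeries_mem hκ.1 lam
  have h1 := iteratedDeriv_mem_CMinusOne hκ (show m + 1 ≤ n - 1 from hm)
  have h2 : (fun t => lam * conv (iteratedDeriv (m + 1) κ) (convSeries κ lam) t) ∈ CMinusOne :=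
    CMinusOne_const_mul lam (CMinusOne_conv h1 hl)
  refine (hasDerivAt_prim (CMinusOne_add h1 h2) ht).congr_of_eventuallyEq ?_
  filter_upwards [Ioi_mem_nhds ht] with s hs
  rw [prim_add h1 h2 hs, prim_const_mul, ← prim_conv h1 hl hs,
    H.iteratedDeriv_eq_prim hκ hm hs]
  congr 2
  exact conv_congr (fun r hr => H.iteratedDeriv_eq_prim hκ hm hr) (fun _ _ => rfl) hs

theorem KernelPair.contDiffOn_convSeries (H : KernelPair n κ k) (hκ : κ ∈ CMinusOneDiff (n - 1))
    (lam : ℝ) : ContDiffOn ℝ ((n - 1 : ℕ) : WithTop ℕ∞) (convSeries κ lam) (Ioi 0) := by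
  have h := contDiffOn_of_hasDerivAt
    (G := fun m t => iteratedDeriv m κ t + lam * conv (iteratedDeriv m κ) (convSeries κ lam) t)
    (H.hasDerivAt_resolvent hκ lam) (continuousOn_of_mem_CMinusOne ?_)
  · refine h.congr fun t ht => ?_
    rw [iteratedDeriv_zero]
    exact convSeries_eq hκ.1 lam ht
  · have h1 := iteratedDeriv_mem_CMinusOne hκ le_rfl
    exact CMinusOne_add h1 (CMinusOne_const_mul lam (CMinusOne_conv h1 (convSeries_mem hκ.1 lam)))

theorem KernelPair.iteratedDeriv_convSeries (H : KernelPair n κ k)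
    (hκ : κ ∈ CMinusOneDiff (n - 1)) (lam : ℝ) {m : ℕ} (hm : m ≤ n - 1) {t : ℝ} (ht : 0 < t) :
    iteratedDeriv m (convSeries κ lam) t =
      iteratedDeriv m κ t + lam * conv (iteratedDeriv m κ) (convSeries κ lam) t := by
  rw [← iteratedDeriv_eq_of_hasDerivAt
    (G := fun m t => iteratedDeriv m κ t + lam * conv (iteratedDeriv m κ) (convSeries κ lam) t)
    (H.hasDerivAt_resolvent hκ lam) hm ht]
  refine iteratedDeriv_congr_of_pos (fun s hs => ?_) m ht
  rw [iteratedDeriv_zero]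
  exact convSeries_eq hκ.1 lam hs

end kernel

/-! ### The two Cauchy problems. -/

section cauchy

variable {n : ℕ} {κ k f γ₀ y g : ℝ → ℝ} {lam : ℝ}

theorem KernelPair.gfi_eq_add_prim_iterate (H : KernelPair n κ k) (hγ : γ₀ ∈ CMinusOne)
    (hg : g ∈ CMinusOne) (hy : ∀ t, 0 < t → y t = γ₀ t + conv κ g t) {t : ℝ} (ht : 0 < t) :
    gfi k y t = gfi k γ₀ t + prim^[n] g t := by
  rw [gfi, conv_congr (fun _ _ => rfl) hy ht,
    conv_add_right H.k_mem_CMinusOne hγ (CMinusOne_conv H.kappa_mem hg) ht,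
    H.conv_conv_eq_prim_iterate hg ht, gfi]

/-- k*y is k*γ₀ plus the n-fold primitive of g, and n derivatives kill the first term. -/
theorem KernelPair.gfd_of_eq_add_conv (H : KernelPair n κ k) (hγ : γ₀ ∈ gfdKer n k)
    (hg : g ∈ CMinusOne) (hy : ∀ t, 0 < t → y t = γ₀ t + conv κ g t) :
    y ∈ gfdDomain n k ∧ ∀ t, 0 < t → gfd n k y t = g t := by
  obtain ⟨⟨hγm, hγc, -⟩, hγ0⟩ := hγ
  have hrep : ∀ t, 0 < t → gfi k y t = gfi k γ₀ t + prim^[n] g t := fun t ht =>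
    H.gfi_eq_add_prim_iterate hγm hg hy ht
  have hd : ∀ t, 0 < t → gfd n k y t = g t := fun t ht => by
    rw [gfd, iteratedDeriv_congr_of_pos hrep n ht,
      iteratedDeriv_fun_add (contDiffAt_of_contDiffOn_Ioi hγc le_rfl ht)
        (contDiffAt_of_contDiffOn_Ioi (contDiffOn_prim_iterate hg n) le_rfl ht),
      iteratedDeriv_prim_iterate hg le_rfl ht]
    have h0 : iteratedDeriv n (gfi k γ₀) t = 0 := hγ0 t ht
    rw [h0]
    simp
  refine ⟨⟨?_, ?_, CMinusOne_congr hg hd⟩, hd⟩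
  · exact CMinusOne_congr (CMinusOne_add hγm (CMinusOne_conv H.kappa_mem hg)) hy
  · exact (hγc.add (contDiffOn_prim_iterate hg n)).congr hrep

theorem KernelPair.solvesProjectorProblem_iff (H : KernelPair n κ k) (hf : f ∈ CMinusOne)
    (hγ : γ₀ ∈ gfdKer n k) :
    SolvesProjectorProblem n κ k lam f γ₀ y ↔
      EqOn y (fun t => conv f (convSeries κ lam) t +
        (γ₀ t + lam * conv γ₀ (convSeries κ lam) t)) (Ioi 0) := by
  have hκ := H.kappa_mem
  have hl := convSeries_mem hκ lam
  have hγm : γ₀ ∈ CMinusOne := hγ.1.1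
  have hκf := CMinusOne_conv hκ hf
  have hw : (fun t => γ₀ t + conv κ f t) ∈ CMinusOne := CMinusOne_add hγm hκf
  -- The Volterra solution w + λ l*w (l the convolution series) in its final form: the terms κ*f + λ
  -- l*(κ*f) are the resolvent identity applied to f.
  have hformula : ∀ t, 0 < t → γ₀ t + conv κ f t +
      lam * conv (convSeries κ lam) (fun t => γ₀ t + conv κ f t) t =
      conv f (convSeries κ lam) t + (γ₀ t + lam * conv γ₀ (convSeries κ lam) t) := fun t ht => by
    rw [conv_add_right hl hγm hκf ht, ← conv_convSeries_comm hκ hf ht, conv_comm f,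
      convSeries_conv hκ hf ht, conv_comm γ₀]
    ring
  have hκy : ∀ y ∈ CMinusOne, ∀ t, 0 < t →
      conv κ (fun s => f s + lam * y s) t = conv κ f t + lam * conv κ y t := fun y hy t ht => by
    rw [conv_add_right hκ hf (CMinusOne_const_mul lam hy) ht, conv_const_mul_right]
  constructor
  · rintro ⟨⟨hy, heq⟩, hproj⟩ t ht
    have hvol := (volterra_iff (lam := lam) hκ hy.1 hw).1 (fun t ht => by
      have h1 := hproj t ht
      rw [projector, gfi, conv_congr (g' := fun s => f s + lam * y s) (fun _ _ => rfl)
        (fun s hs => by rw [← heq s hs]; ring) ht, hκy y hy.1 t ht] at h1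
      linarith) t ht
    exact hvol.trans (hformula t ht)
  · intro h
    have hy : y ∈ CMinusOne := CMinusOne_congr
      (CMinusOne_add (CMinusOne_conv hf hl)
        (CMinusOne_add hγm (CMinusOne_const_mul lam (CMinusOne_conv hγm hl)))) fun t ht => h ht
    have hvol := (volterra_iff (lam := lam) hκ hy hw).2 fun t ht =>
      (h ht).trans (hformula t ht).symm
    have hg : (fun s => f s + lam * y s) ∈ CMinusOne := CMinusOne_add hf (CMinusOne_const_mul lam hy)
    have hyg : ∀ t, 0 < t → y t = γ₀ t + conv κ (fun s => f s + lam * y s) t := fun t ht => by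
      rw [hκy y hy t ht, ← add_assoc]
      exact hvol t ht
    obtain ⟨hdom, hd⟩ := H.gfd_of_eq_add_conv hγ hg hyg
    refine ⟨⟨hdom, fun t ht => by rw [hd t ht]; ring⟩, fun t ht => ?_⟩
    rw [projector, gfi, conv_congr (fun _ _ => rfl) hd ht, hyg t ht]
    ring

/-- The element of the null space of `D_(k)` with initial values `a`. -/
noncomputable def kerElement {n : ℕ} (κ : ℝ → ℝ) (a : Fin n → ℝ) (t : ℝ) : ℝ :=
  ∑ i : Fin n, a i * iteratedDeriv (n - 1 - (i : ℕ)) κ t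

variable {a : Fin n → ℝ}

theorem kerElement_mem_CMinusOne (hκ : κ ∈ CMinusOneDiff (n - 1)) :
    kerElement κ a ∈ CMinusOne :=
  CMinusOne_sum _ fun i _ =>
    CMinusOne_const_mul (a i) (iteratedDeriv_mem_CMinusOne hκ (Nat.sub_le _ _))

theorem KernelPair.gfi_kerElement (H : KernelPair n κ k) (hκ : κ ∈ CMinusOneDiff (n - 1))
    {t : ℝ} (ht : 0 < t) : gfi k (kerElement κ a) t = taylorPoly a t := by
  have hmem : ∀ i : Fin n, iteratedDeriv (n - 1 - (i : ℕ)) κ ∈ CMinusOne := fun i =>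
    iteratedDeriv_mem_CMinusOne hκ (Nat.sub_le _ _)
  refine (conv_sum_right Finset.univ H.k_mem_CMinusOne
    (fun i _ => CMinusOne_const_mul (a i) (hmem i)) ht).trans ?_
  refine Finset.sum_congr rfl fun i _ => ?_
  rw [conv_const_mul_right, H.conv_iteratedDeriv hκ (Nat.sub_le _ _) ht,
    show n - 1 - (n - 1 - (i : ℕ)) = i by have := i.2; omega]

theorem KernelPair.kerElement_mem_gfdKer (H : KernelPair n κ k)
    (hκ : κ ∈ CMinusOneDiff (n - 1)) : kerElement κ a ∈ gfdKer n k := by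
  have hrep : ∀ t, 0 < t → gfi k (kerElement κ a) t = taylorPoly a t := fun t ht =>
    H.gfi_kerElement hκ ht
  have h0 : ∀ t, 0 < t → gfd n k (kerElement κ a) t = 0 := fun t ht => by
    rw [gfd, iteratedDeriv_congr_of_pos hrep n ht, iteratedDeriv_taylorPoly_self]
  exact ⟨⟨kerElement_mem_CMinusOne hκ, (contDiff_taylorPoly a).contDiffOn.congr hrep,
    CMinusOne_congr (CMinusOne_const 0) h0⟩, h0⟩

/-- The bridge between the two kinds of condition: k carries the kernel element to the Taylor
polynomial of `a` and κ*D_(k)y to the n-fold primitive of D_(k)y. The backward direction cancels k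
by injectivity. -/
theorem KernelPair.projector_eq_kerElement_iff (H : KernelPair n κ k)
    (hκ : κ ∈ CMinusOneDiff (n - 1)) (hy : y ∈ gfdDomain n k) :
    (∀ t, 0 < t → projector n κ k y t = kerElement κ a t) ↔
      ∀ i : Fin n, Tendsto (iteratedDeriv (i : ℕ) (gfi k y)) (𝓝[>] 0) (𝓝 (a i)) := by
  obtain ⟨hym, hyc, hyg⟩ := hy
  have hker := kerElement_mem_CMinusOne (a := a) hκ
  constructor
  · intro h i
    have hrep : ∀ t, 0 < t → gfi k y t = taylorPoly a t + prim^[n] (gfd n k y) t := fun t ht => by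
      rw [H.gfi_eq_add_prim_iterate hker hyg (fun s hs => ?_) ht, H.gfi_kerElement hκ ht]
      rw [← h s hs, projector, gfi]
      ring
    refine (tendsto_iteratedDeriv_taylorPoly_add hyg i).congr' ?_
    filter_upwards [self_mem_nhdsWithin] with t ht
    exact (iteratedDeriv_congr_of_pos hrep i ht).symm
  · intro h t ht
    have hz := CMinusOne_add hker (CMinusOne_conv H.kappa_mem hyg)
    have heq := H.eq_of_conv_eq hκ hym hz (fun t ht => by
      refine (eq_taylorPoly_add_prim_iterate hyc hyg h ht).trans ?_
      rw [← H.gfi_kerElement hκ ht]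
      exact (H.gfi_eq_add_prim_iterate hker hyg (fun _ _ => rfl) ht).symm) ht
    rw [projector, gfi, heq]
    ring

theorem KernelPair.solvesInitialValueProblem_iff (H : KernelPair n κ k)
    (hκ : κ ∈ CMinusOneDiff (n - 1)) (hf : f ∈ CMinusOne) :
    SolvesInitialValueProblem n k lam f a y ↔
      EqOn y (fun t => conv f (convSeries κ lam) t +
        ∑ i : Fin n, a i * iteratedDeriv (n - 1 - (i : ℕ)) (convSeries κ lam) t) (Ioi 0) := by
  have hl := convSeries_mem hκ.1 lam
  have h1 : SolvesInitialValueProblem n k lam f a y ↔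
      SolvesProjectorProblem n κ k lam f (kerElement κ a) y :=
    and_congr_right fun hy => (H.projector_eq_kerElement_iff hκ hy.1).symm
  rw [h1, H.solvesProjectorProblem_iff hf (H.kerElement_mem_gfdKer hκ)]
  -- γ₀ + λ γ₀*l, with l the convolution series, becomes ∑ a_i l^{(n-1-i)} because the derivatives
  -- of l satisfy l^{(m)} = κ^{(m)} + λ κ^{(m)}*l for m ≤ n-1.
  have h2 : EqOn (fun t => conv f (convSeries κ lam) t +
      (kerElement κ a t + lam * conv (kerElement κ a) (convSeries κ lam) t))
      (fun t => conv f (convSeries κ lam) t +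
        ∑ i : Fin n, a i * iteratedDeriv (n - 1 - (i : ℕ)) (convSeries κ lam) t) (Ioi 0) := by
    intro t ht
    have hmem : ∀ i : Fin n, iteratedDeriv (n - 1 - (i : ℕ)) κ ∈ CMinusOne := fun i =>
      iteratedDeriv_mem_CMinusOne hκ (Nat.sub_le _ _)
    have h3 : conv (kerElement κ a) (convSeries κ lam) t =
        ∑ i : Fin n, a i * conv (iteratedDeriv (n - 1 - (i : ℕ)) κ) (convSeries κ lam) t := by
      rw [conv_comm]
      refine (conv_sum_right Finset.univ hl
        (fun i _ => CMinusOne_const_mul (a i) (hmem i)) ht).trans ?_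
      refine Finset.sum_congr rfl fun i _ => ?_
      rw [conv_const_mul_right, conv_comm]
    simp only
    rw [h3, kerElement, Finset.mul_sum, ← Finset.sum_add_distrib]
    congr 1
    refine Finset.sum_congr rfl fun i _ => ?_
    rw [H.iteratedDeriv_convSeries hκ lam (Nat.sub_le _ _) ht]
    ring
  exact ⟨fun h => h.trans h2, fun h => h.trans h2.symm⟩

theorem KernelPair.zero_mem_gfdKer (H : KernelPair n κ k) (hκ : κ ∈ CMinusOneDiff (n - 1)) :
    (fun _ => 0) ∈ gfdKer n k := by
  have h := H.kerElement_mem_gfdKer (a := fun _ => 0) hκ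
  have e : kerElement κ (fun _ : Fin n => 0) = fun _ => 0 := by
    ext t
    simp [kerElement]
  rwa [e] at h

end cauchy

end GenFrac

/-! ### The theorem. -/

theorem theorem8 (n : ℕ) (κ k : ℝ → ℝ) (hκk : GenFrac.KernelPair n κ k)
    (hκ : κ ∈ GenFrac.CMinusOneDiff (n - 1))
    (f : ℝ → ℝ) (hf : f ∈ GenFrac.CMinusOne) (lam : ℝ) :
    -- the convolution series converges, lies in `C_{-1}`, and is `n - 1` times differentiable
    (∀ t : ℝ, 0 < t → Summable fun j : ℕ => lam ^ j * GenFrac.convPow κ (j + 1) t) ∧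
    GenFrac.convSeries κ lam ∈ GenFrac.CMinusOne ∧
    ContDiffOn ℝ ((n - 1 : ℕ) : WithTop ℕ∞) (GenFrac.convSeries κ lam) (Set.Ioi 0) ∧
    -- the unique solution for the initial condition `F y = γ₀`, and its two parts
    (∀ γ₀ ∈ GenFrac.gfdKer n k,
      (∀ y : ℝ → ℝ, GenFrac.SolvesProjectorProblem n κ k lam f γ₀ y ↔
        Set.EqOn y (fun t => GenFrac.conv f (GenFrac.convSeries κ lam) t +
          (γ₀ t + lam * GenFrac.conv γ₀ (GenFrac.convSeries κ lam) t)) (Set.Ioi 0)) ∧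
      (∀ y : ℝ → ℝ, GenFrac.SolvesProjectorProblem n κ k lam f (fun _ => 0) y ↔
        Set.EqOn y (GenFrac.conv f (GenFrac.convSeries κ lam)) (Set.Ioi 0)) ∧
      (∀ y : ℝ → ℝ, GenFrac.SolvesProjectorProblem n κ k lam (fun _ => 0) γ₀ y ↔
        Set.EqOn y (fun t => γ₀ t + lam * GenFrac.conv γ₀ (GenFrac.convSeries κ lam) t)
          (Set.Ioi 0))) ∧
    -- the unique solution for the initial conditions `((d/dt)^i I_(k) y)(0) = a_i`,
    -- and its two parts
    (∀ a : Fin n → ℝ,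
      (∀ y : ℝ → ℝ, GenFrac.SolvesInitialValueProblem n k lam f a y ↔
        Set.EqOn y (fun t => GenFrac.conv f (GenFrac.convSeries κ lam) t +
          ∑ i : Fin n, a i *
            iteratedDeriv (n - 1 - (i : ℕ)) (GenFrac.convSeries κ lam) t) (Set.Ioi 0)) ∧
      (∀ y : ℝ → ℝ, GenFrac.SolvesInitialValueProblem n k lam f (fun _ => 0) y ↔
        Set.EqOn y (GenFrac.conv f (GenFrac.convSeries κ lam)) (Set.Ioi 0)) ∧
      (∀ y : ℝ → ℝ, GenFrac.SolvesInitialValueProblem n k lam (fun _ => 0) a y ↔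
        Set.EqOn y (fun t => ∑ i : Fin n, a i *
          iteratedDeriv (n - 1 - (i : ℕ)) (GenFrac.convSeries κ lam) t) (Set.Ioi 0))) := by
  have hzero : (fun _ : ℝ => (0 : ℝ)) ∈ GenFrac.CMinusOne := GenFrac.CMinusOne_const 0
  refine ⟨fun t ht => GenFrac.summable_convSeries hκ.1 lam ht, GenFrac.convSeries_mem hκ.1 lam,
    hκk.contDiffOn_convSeries hκ lam, fun γ₀ hγ => ⟨fun y => ?_, fun y => ?_, fun y => ?_⟩,
    fun a => ⟨fun y => ?_, fun y => ?_, fun y => ?_⟩⟩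
  · exact hκk.solvesProjectorProblem_iff hf hγ
  · rw [hκk.solvesProjectorProblem_iff hf (hκk.zero_mem_gfdKer hκ)]
    simp only [GenFrac.conv_zero_left, mul_zero, add_zero]
  · rw [hκk.solvesProjectorProblem_iff hzero hγ]
    simp only [GenFrac.conv_zero_left, zero_add]
  · exact hκk.solvesInitialValueProblem_iff hκ hf
  · rw [hκk.solvesInitialValueProblem_iff hκ hf]
    simp only [zero_mul, Finset.sum_const_zero, add_zero]
  · rw [hκk.solvesInitialValueProblem_iff hκ hzero]
    simp only [GenFrac.conv_zero_left, zero_add]
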